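/- Conventions. Let $S_0(\mathbb{R})=\{f\in L^2(\mathbb{R}) : V_gf\in L^1(\mathbb{R}^2)\}$ be the Feichtinger algebra, where $V_gf(t,\nu)=\int f(x)e^{-2\pi i\nu x}g(x-t)\,dx$ with $g(x)=e^{-\pi x^2}$, normed by $\|f\|_{S_0}=\|V_gf\|_{L^1}$; its elements are identified with their continuous representatives, and $S_0'(\mathbb{R})$ is its dual. A Hilbert–Schmidt operator $H$ on $L^2(\mathbb{R})$ is a bounded operator $Hf(x)=\int\kappa_H(x,t)f(t)\,dt$ with kernel $\kappa_H\in L^2(\mathbb{R}^2)$, and $\|H\|_{HS}=\|\kappa_H\|_{L^2}$. Its Kohn–Nirenberg symbol is $\sigma_H(x,\xi)=\int\kappa_H(x,x-t)e^{-2\pi it\xi}\,dt$ and its spreading function is $\eta_H(t,\nu)=\int\kappa_H(x,x-t)e^{-2\pi ix\nu}\,dx$ (Fourier transforms in the $L^2$ sense). With the symplectic Fourier transform $\mathcal F_s f(t,\nu)=\iint f(x,\xi)e^{-2\pi i(\nu x-\xi t)}\,dx\,d\xi$ on $L^2(\mathbb{R}^2)$, one has $\mathcal F_s\sigma_H=\eta_H$.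 For $S\subseteq\mathbb{R}^2$ let $$OPW(S)=\{H \text{ Hilbert–Schmidt on } L^2(\mathbb{R}) : \operatorname{supp}\mathcal F_s\sigma_H\subseteq S\}.$$ For $\varphi\in S_0'(\mathbb{R})$, the value $H\varphi\in L^2(\mathbb{R})$, when it exists, is defined by the weak formula $$\langle H\varphi,\psi\rangle=\iint\eta_H(t,\nu)\,\langle M_\nu T_t\varphi,\psi\rangle\,dt\,d\nu\quad\text{for all }\psi\in S_0(\mathbb{R}),$$ with absolutely convergent integrals, where $T_tf(x)=f(x-t)$ and $M_\nu f(x)=e^{2\pi i\nu x}f(x)$. A sequence $\Lambda=\{\lambda_k\}_{k\in\mathbb{Z}}$ of real numbers is a set of sampling for a class $\mathcal H$ of Hilbert–Schmidt operators if there is a bounded complex sequence $\{c_k\}_{k\in\mathbb{Z}}$ such that $\varphi=\sum_k c_k\delta_{\lambda_k}$ converges weakly to an element of $S_0'(\mathbb{R})$, $H\varphi\in L^2(\mathbb{R})$ exists for every $H\in\mathcal H$, and there are constants $A,B>0$ with $$A\|H\|_{HS}\le\|H\varphi\|_{L^2}\le B\|H\|_{HS}\quad\text{for all }H\in\mathcal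 H.$$ Corollary 4.4. Let $T,\Omega>0$ with $T\Omega\le 1$, and let $\Lambda=\{\lambda_k\}_{k\in\mathbb{Z}}\subset\mathbb{R}$ satisfy $\lambda_k<\lambda_{k+1}$ for all $k\in\mathbb{Z}$. If there is $L\ge 0$ such that $$|\lambda_k-kT|\le L<\tfrac{T}{4}\quad\text{and}\quad\lambda_{k+1}-\lambda_k\ge T\qquad\text{for all }k\in\mathbb{Z},$$ then $\Lambda$ is a set of sampling for $OPW\big([0,T]\times[-\tfrac{\Omega}{2},\tfrac{\Omega}{2}]\big)$. -/

import Mathlib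

open MeasureTheory Real Set Filter Topology
open scoped FourierTransform ENNReal

namespace OperatorSampling

/-- The Hilbert space `L²(ℝ)` of complex-valued functions. -/
abbrev L2R : Type := Lp ℂ 2 (volume : Measure ℝ)

/-- The Hilbert space `L²(ℝ²)` of complex-valued functions. -/
abbrev L2R2 : Type := Lp ℂ 2 (volume : Measure (ℝ × ℝ))

/-! ### The Feichtinger algebra and its dual -/

/-- The Gaussian window `g(x) = exp (-π x²)`. -/
noncomputable def gauss (x : ℝ) : ℂ := ((Real.exp (-π * x ^ 2) : ℝ) : ℂ)

/-- The character `x ↦ exp (2 π i ν x)`. -/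
noncomputable def expi (ν x : ℝ) : ℂ := Complex.exp (2 * π * Complex.I * ν * x)

/-- The short-time Fourier transform with Gaussian window,
`V_g f (t, ν) = ⟨f, M_ν T_t g⟩ = ∫ f(x) exp(-2πiνx) g(x - t) dx` (`g` is real valued). -/
noncomputable def stft (f : ℝ → ℂ) (p : ℝ × ℝ) : ℂ :=
  ∫ x, f x * expi (-p.2) x * gauss (x - p.1)

/-- Membership in the Feichtinger algebra `S₀(ℝ)`: square integrable functions whose short-time
Fourier transform is integrable on `ℝ²`. Every class in `L²(ℝ)` with this property has exactly one
continuous representative, and elements of `S₀(ℝ)` are identified with this representative, so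
that point evaluations make sense. -/
structure MemS0 (f : ℝ → ℂ) : Prop where
  continuous : Continuous f
  memLp : MemLp f 2 volume
  integrable_stft : Integrable (stft f) (volume : Measure (ℝ × ℝ))

theorem norm_expi (ν x : ℝ) : ‖expi ν x‖ = 1 := by
  have h : (2 * π * Complex.I * ν * x : ℂ) = ((2 * π * ν * x : ℝ) : ℂ) * Complex.I := by
    push_cast; ring
  rw [expi, h, Complex.norm_exp_ofReal_mul_I]

theorem expi_add (ν x y : ℝ) : expi ν (x + y) = expi ν x * expi ν y := by
  rw [expi, expi, expi, ← Complex.exp_add]; congr 1; push_cast; ring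

theorem expi_add_left (ν ω x : ℝ) : expi (ν + ω) x = expi ν x * expi ω x := by
  rw [expi, expi, expi, ← Complex.exp_add]; congr 1; push_cast; ring

theorem continuous_expi (ν : ℝ) : Continuous (expi ν) := by unfold expi; fun_prop

theorem continuous_gauss : Continuous gauss := by unfold gauss; fun_prop

theorem memLp_gauss (t : ℝ) : MemLp (fun x => gauss (x - t)) 2 volume := by
  have h0 : MemLp gauss 2 volume := by
    rw [memLp_two_iff_integrable_sq_norm continuous_gauss.aestronglyMeasurable]
    have h := integrable_exp_neg_mul_sq (b := 2 * π) (by positivity)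
    refine h.congr (Eventually.of_forall fun x => ?_)
    simp only [gauss, Complex.norm_real, Real.norm_eq_abs, abs_exp]
    rw [← Real.exp_nat_mul]; congr 1; push_cast; ring
  exact h0.comp_measurePreserving (measurePreserving_sub_right volume t)

theorem integrable_stft_integrand {f : ℝ → ℂ} (hf : MemLp f 2 volume) (p : ℝ × ℝ) :
    Integrable (fun x => f x * expi (-p.2) x * gauss (x - p.1)) volume := by
  have h : Integrable (fun x => f x * gauss (x - p.1)) volume := hf.integrable_mul (memLp_gauss p.1)
  have h2 := h.bdd_mul (continuous_expi (-p.2)).aestronglyMeasurable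
    (Eventually.of_forall fun x => (norm_expi (-p.2) x).le)
  refine h2.congr (Eventually.of_forall fun x => ?_)
  simp only; ring

/-- The Feichtinger algebra `S₀(ℝ)` as a space of continuous functions. -/
def S0 : Submodule ℂ (ℝ → ℂ) where
  carrier := {f | MemS0 f}
  zero_mem' := by
    refine ⟨continuous_const, MemLp.zero, ?_⟩
    have h : stft 0 = 0 := by funext p; simp [stft]
    rw [h]; exact integrable_zero _ _ _
  add_mem' := by
    intro f g hf hg
    refine ⟨hf.continuous.add hg.continuous, hf.memLp.add hg.memLp, ?_⟩
    have h : stft (f + g) = stft f + stft g := by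
      funext p
      simp only [stft, Pi.add_apply, add_mul]
      exact integral_add (integrable_stft_integrand hf.memLp p)
        (integrable_stft_integrand hg.memLp p)
    rw [h]; exact hf.integrable_stft.add hg.integrable_stft
  smul_mem' := by
    intro c f hf
    refine ⟨hf.continuous.const_smul c, hf.memLp.const_smul c, ?_⟩
    have h : stft (c • f) = c • stft f := by
      funext p
      simp only [stft, Pi.smul_apply, smul_eq_mul, mul_assoc]
      exact integral_const_mul _ _
    rw [h]; exact hf.integrable_stft.smul c

/-- The norm of `S₀(ℝ)`: `‖f‖_{S₀} = ‖V_g f‖_{L¹}`. -/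
noncomputable def S0norm (f : S0) : ℝ := ∫ p : ℝ × ℝ, ‖stft (f : ℝ → ℂ) p‖

/-- The dual space `S₀'(ℝ)`: linear functionals bounded with respect to the norm of `S₀(ℝ)`. A
locally integrable function `f` in it acts by the bilinear pairing `g ↦ ∫ f g`. -/
structure S0Dual where
  toLinearMap : S0 →ₗ[ℂ] ℂ
  bounded : ∃ C : ℝ, ∀ g : S0, ‖toLinearMap g‖ ≤ C * S0norm g

/-- The transpose of `M_ν T_t` for the bilinear pairing `(f, g) ↦ ∫ f g`:
`∫ exp(2πiνx) f(x - t) g(x) dx = ∫ f(y) exp(2πiν(y + t)) g(y + t) dy`. -/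
noncomputable def tfTransposeFun (t ν : ℝ) (g : ℝ → ℂ) (y : ℝ) : ℂ :=
  expi ν (y + t) * g (y + t)

theorem stft_tfTransposeFun (t ν : ℝ) (g : ℝ → ℂ) (p : ℝ × ℝ) :
    stft (tfTransposeFun t ν g) p = expi p.2 t * stft g (p + (t, -ν)) := by
  have h : stft g (p + (t, -ν)) =
      ∫ x, g (x + t) * expi (-(p.2 + -ν)) (x + t) * gauss (x + t - (p.1 + t)) := by
    rw [stft, ← integral_add_right_eq_self _ t]; rfl
  rw [h, stft, ← integral_const_mul]
  refine integral_congr_ae (Eventually.of_forall fun x => ?_)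
  simp only [tfTransposeFun]
  have h1 : x + t - (p.1 + t) = x - p.1 := by ring
  have h2 : expi (-(p.2 + -ν)) (x + t) = expi (-p.2) x * expi (-p.2) t * expi ν (x + t) := by
    rw [← expi_add, ← expi_add_left]; congr 1; ring
  have h3 : expi p.2 t * expi (-p.2) t = 1 := by
    rw [← expi_add_left]; simp [expi]
  rw [h1, h2]
  linear_combination (-(g (x + t) * expi (-p.2) x * expi ν (x + t) * gauss (x - p.1))) * h3

theorem MemS0.tfTranspose {g : ℝ → ℂ} (hg : MemS0 g) (t ν : ℝ) :
    MemS0 (tfTransposeFun t ν g) := by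
  have hc : Continuous (tfTransposeFun t ν g) := by
    have h1 := continuous_expi ν
    have h2 := hg.continuous
    unfold tfTransposeFun; fun_prop
  refine ⟨hc, ?_, ?_⟩
  · have h : MemLp (fun y => g (y + t)) 2 volume :=
      hg.memLp.comp_measurePreserving (measurePreserving_add_right volume t)
    refine h.of_le hc.aestronglyMeasurable (Eventually.of_forall fun y => ?_)
    simp [tfTransposeFun, norm_expi]
  · have h : Integrable (fun p : ℝ × ℝ => stft g (p + (t, -ν))) volume :=
      hg.integrable_stft.comp_add_right (t, -ν)
    have hm : Continuous fun p : ℝ × ℝ => expi p.2 t := by unfold expi; fun_prop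
    have h2 := h.bdd_mul hm.aestronglyMeasurable
      (Eventually.of_forall fun p => (norm_expi p.2 t).le)
    exact h2.congr (Eventually.of_forall fun p => (stft_tfTransposeFun t ν g p).symm)

/-- `tfTransposeFun` on `S₀(ℝ)`. -/
noncomputable def tfTranspose (t ν : ℝ) (g : S0) : S0 :=
  ⟨tfTransposeFun t ν g, MemS0.tfTranspose g.2 t ν⟩

/-- The pairing of the time-frequency shift `M_ν T_t φ` of `φ ∈ S₀'(ℝ)` with `g ∈ S₀(ℝ)`. -/
noncomputable def S0Dual.tfPairing (φ : S0Dual) (t ν : ℝ) (g : S0) : ℂ :=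
  φ.toLinearMap (tfTranspose t ν g)

/-! ### Hilbert–Schmidt operators, Kohn–Nirenberg symbol, spreading function -/

/-- A Hilbert–Schmidt operator on `L²(ℝ)`: a bounded operator with
`H f (x) = ∫ κ(x, t) f(t) dt` for a kernel `κ ∈ L²(ℝ²)`. Operator and kernel determine each
other. -/
structure HilbertSchmidt where
  op : L2R →L[ℂ] L2R
  kernel : L2R2
  represents : ∀ f : L2R, (op f : ℝ → ℂ) =ᵐ[volume] fun x => ∫ t, kernel (x, t) * f t

/-- The Hilbert–Schmidt norm, i.e. the `L²(ℝ²)` norm of the kernel. -/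
noncomputable def HilbertSchmidt.hsNorm (H : HilbertSchmidt) : ℝ := ‖H.kernel‖

/-- The time-varying impulse response `h_H(t, x) = κ_H(x, x - t)`. -/
noncomputable def HilbertSchmidt.impulseResponse (H : HilbertSchmidt) (t x : ℝ) : ℂ :=
  H.kernel (x, x - t)

/-- `F` is (a.e. equal to) the `L²(ℝ)` Fourier transform of `f`,
`F(ξ) = ∫ f(t) exp(-2πitξ) dt` in the `L²` sense. -/
def IsL2Fourier (f F : ℝ → ℂ) : Prop :=
  ∃ hf : MemLp f 2 volume, F =ᵐ[volume] (𝓕 (hf.toLp f) : L2R)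

/-- `σ` is the Kohn–Nirenberg symbol of `H`:
`σ(x, ξ) = ∫ κ_H(x, x - t) exp(-2πitξ) dt`, a Fourier transform in the `L²` sense for a.e. `x`. -/
def IsKNSymbol (H : HilbertSchmidt) (σ : ℝ × ℝ → ℂ) : Prop :=
  MemLp σ 2 volume ∧
    ∀ᵐ x : ℝ, IsL2Fourier (fun t => H.impulseResponse t x) (fun ξ => σ (x, ξ))

/-- `η` is the spreading function of `H`:
`η(t, ν) = ∫ κ_H(x, x - t) exp(-2πixν) dx`, a Fourier transform in the `L²` sense for a.e. `t`. -/
def IsSpreadingFunction (H : HilbertSchmidt) (η : ℝ × ℝ → ℂ) : Prop :=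
  MemLp η 2 volume ∧
    ∀ᵐ t : ℝ, IsL2Fourier (fun x => H.impulseResponse t x) (fun ν => η (t, ν))

/-- `F` is the symplectic Fourier transform of `f` on `L²(ℝ²)`,
`F(t, ν) = ∫∫ f(x, ξ) exp(-2πi(νx - ξt)) dx dξ`, computed as an iterated transform in the `L²`
sense: `G(t, x) = ∫ f(x, ξ) exp(2πiξt) dξ` (so that `f(x, ·)` is the Fourier transform of
`G(·, x)`), followed by `F(t, ν) = ∫ G(t, x) exp(-2πixν) dx`. -/
def IsSymplecticFourier (f F : ℝ × ℝ → ℂ) : Prop :=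
  MemLp f 2 volume ∧ MemLp F 2 volume ∧
    ∃ G : ℝ × ℝ → ℂ, MemLp G 2 volume ∧
      (∀ᵐ x : ℝ, IsL2Fourier (fun t => G (t, x)) (fun ξ => f (x, ξ))) ∧
      (∀ᵐ t : ℝ, IsL2Fourier (fun x => G (t, x)) (fun ν => F (t, ν)))

/-- The (essential) support of a measurable function on `ℝ²`: the complement of the largest open
set on which the function vanishes almost everywhere. -/
def essSupport (F : ℝ × ℝ → ℂ) : Set (ℝ × ℝ) :=
  {p | ∀ U ∈ 𝓝 p, ¬ (∀ᵐ q : ℝ × ℝ, q ∈ U → F q = 0)}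

/-- The operator Paley–Wiener space `OPW(S)`: Hilbert–Schmidt operators whose Kohn–Nirenberg
symbol `σ_H` satisfies `supp F_s σ_H ⊆ S`. -/
def OPW (S : Set (ℝ × ℝ)) : Set HilbertSchmidt :=
  {H | ∃ σ F : ℝ × ℝ → ℂ, IsKNSymbol H σ ∧ IsSymplecticFourier σ F ∧ essSupport F ⊆ S}

/-! ### Identification and sampling -/

/-- `u ∈ L²(ℝ)` is the value `H φ` at `φ ∈ S₀'(ℝ)` of the extension of `H` given by the weak formula
`⟨H φ, g⟩ = ∫∫ η_H(t, ν) ⟨M_ν T_t φ, g⟩ dt dν` for all `g ∈ S₀(ℝ)`, the integral being absolutely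
convergent. -/
def IsValueAt (H : HilbertSchmidt) (φ : S0Dual) (u : L2R) : Prop :=
  ∃ η : ℝ × ℝ → ℂ, IsSpreadingFunction H η ∧ ∀ g : S0,
    Integrable (fun p : ℝ × ℝ => η p * φ.tfPairing p.1 p.2 g) volume ∧
      ∫ x, u x * (g : ℝ → ℂ) x = ∫ p : ℝ × ℝ, η p * φ.tfPairing p.1 p.2 g

/-- `φ ∈ S₀'(ℝ)` identifies the operator class `𝓗`: every `H ∈ 𝓗` extends to `φ`, with
`H φ ∈ L²(ℝ)`, and `‖H‖_{HS} ≍ ‖H φ‖_{L²}` for `H ∈ 𝓗`. -/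
def Identifies (φ : S0Dual) (𝓗 : Set HilbertSchmidt) : Prop :=
  ∃ A B : ℝ, 0 < A ∧ 0 < B ∧ ∀ H ∈ 𝓗, ∃ u : L2R, IsValueAt H φ u ∧
    A * H.hsNorm ≤ ‖u‖ ∧ ‖u‖ ≤ B * H.hsNorm

/-- `{Λ k}` is a set of sampling for `𝓗`: for some bounded sequence `c`, the sum
`∑ c_k δ_{Λ k}` converges (weakly) to an element of `S₀'(ℝ)` that identifies `𝓗`. -/
def IsSetOfSampling (Λ : ℤ → ℝ) (𝓗 : Set HilbertSchmidt) : Prop :=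
  ∃ c : ℤ → ℂ, (∃ M : ℝ, ∀ k, ‖c k‖ ≤ M) ∧
    ∃ φ : S0Dual,
      (∀ g : S0, HasSum (fun k : ℤ => c k * (g : ℝ → ℂ) (Λ k)) (φ.toLinearMap g)) ∧
      Identifies φ 𝓗

end OperatorSampling

namespace OperatorSampling

/-! All weights are taken to be `1`, so the test signal is the Dirac comb at the points `Λ k`. Let
`h(t, x) = ∫ η(t, ν) e(νx) dν` be the impulse response of `H`, where `e(s) = exp(2πis)`. The
response to the comb is `∑ h(x - Λ k, x)`. Since `h(t, ·)` vanishes for `t ∉ [0, T)` and the gaps of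
`Λ` are at least `T`, the summands have disjoint supports, and the substitution `x = t + Λ k` gives
`‖Hφ‖² = ∫ ∑ |h(t, t + Λ k)|² dt` (`lintegral_enorm_sq_combResponse`).

For fixed `t` the inner sum samples a function whose band `[-Ω/2, Ω/2]` lies in `[-1/(2T), 1/(2T)]`,
because `TΩ ≤ 1`. As `|Λ k - kT| ≤ L < T/4`, Kadec's 1/4 theorem (`exists_frame_bounds`) makes this
sum comparable to `‖η(t, ·)‖²`, with constants independent of `t`. Integration over `t` yields `‖η‖²
= ‖H‖²_HS`.

Kadec's theorem is proved by perturbing Parseval's identity at the points `kT`. The error multiplier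
`e(νδ) - 1` is the integral of its derivative in `δ`, split into a sine and a cosine part. Bessel's
inequality bounds each part uniformly in the signs of the shifts, and the total error is at most the
factor `1 - cos(πL/T) + sin(πL/T) < 1`.

That the comb lies in `S₀'` follows from `sum_norm_le_S0norm`; the weak formula is a Fubini argument
(`integrable_and_integral_combResponse_mul`). -/

theorem continuous_expi_uncurry : Continuous fun p : ℝ × ℝ => expi p.1 p.2 := by
  unfold expi; fun_prop

theorem continuous_expi_left (x : ℝ) : Continuous fun ν : ℝ => expi ν x := by
  unfold expi; fun_prop

/-! ### Kadec's 1/4 theorem for functions of bandwidth `1/T` -/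

/-- Parseval's identity on the interval `(-1/(2T), 1/(2T)]` of length `1/T`. -/
theorem hasSum_sq_norm_integral_expi {T : ℝ} (hT : 0 < T) {G : ℝ → ℂ}
    (hG : MemLp G 2 (volume.restrict (Ioc (-(1 / (2 * T))) (1 / (2 * T))))) :
    HasSum (fun k : ℤ => ‖∫ ν in Ioc (-(1 / (2 * T))) (1 / (2 * T)), G ν * expi ν (k * T)‖ ^ 2)
      (T⁻¹ * ∫ ν in Ioc (-(1 / (2 * T))) (1 / (2 * T)), ‖G ν‖ ^ 2) := by
  have hab : -(1 / (2 * T)) < 1 / (2 * T) := by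
    have : 0 < 1 / (2 * T) := by positivity
    linarith
  have hlen : 1 / (2 * T) - -(1 / (2 * T)) = T⁻¹ := by field_simp; ring
  have h := hasSum_sq_fourierCoeffOn hab hG
  -- Fourier coefficients use the conjugate character, hence `k ↦ -k`; they also carry the factor
  -- `1/(b - a) = T`, which `T⁻²` removes after squaring.
  have h2 := ((Equiv.neg ℤ).hasSum_iff.mpr h).mul_left ((T⁻¹) ^ 2)
  have e1 : T⁻¹ * ∫ ν in Ioc (-(1 / (2 * T))) (1 / (2 * T)), ‖G ν‖ ^ 2 =
      (T⁻¹) ^ 2 * ((1 / (2 * T) - -(1 / (2 * T)))⁻¹ •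
        ∫ x in (-(1 / (2 * T)))..(1 / (2 * T)), ‖G x‖ ^ 2) := by
    rw [intervalIntegral.integral_of_le hab.le, hlen, smul_eq_mul]
    field_simp
  rw [e1]
  refine h2.congr_fun fun k => ?_
  have e2 : ∀ x : ℝ, fourier (-(-k)) (x : AddCircle (1 / (2 * T) - -(1 / (2 * T)))) • G x =
      G x * expi x (k * T) := by
    intro x
    rw [fourier_coe_apply, hlen, smul_eq_mul, mul_comm, expi]
    congr 2
    push_cast
    field_simp
  simp only [Function.comp, Equiv.neg_apply]
  rw [fourierCoeffOn_eq_integral, norm_smul, intervalIntegral.integral_of_le hab.le]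
  simp_rw [e2]
  rw [hlen, mul_pow, ← mul_assoc]
  simp only [one_div, inv_inv, norm_eq_abs, sq_abs]
  field_simp

/-- Bessel's inequality after multiplication by a bounded function. -/
theorem sum_sq_norm_integral_mul_expi_le {T : ℝ} (hT : 0 < T) {G m : ℝ → ℂ} {w : ℝ}
    (hG : MemLp G 2 (volume.restrict (Ioc (-(1 / (2 * T))) (1 / (2 * T)))))
    (hm : Continuous m) (hw : ∀ ν ∈ Ioc (-(1 / (2 * T))) (1 / (2 * T)), ‖m ν‖ ≤ w)
    (K : Finset ℤ) :
    ∑ k ∈ K, ‖∫ ν in Ioc (-(1 / (2 * T))) (1 / (2 * T)), m ν * G ν * expi ν (k * T)‖ ^ 2 ≤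
      w ^ 2 * (T⁻¹ * ∫ ν in Ioc (-(1 / (2 * T))) (1 / (2 * T)), ‖G ν‖ ^ 2) := by
  have hae : ∀ᵐ ν ∂(volume.restrict (Ioc (-(1 / (2 * T))) (1 / (2 * T)))), ‖m ν‖ ≤ w :=
    (ae_restrict_iff' measurableSet_Ioc).mpr (Eventually.of_forall hw)
  have hmG : MemLp (fun ν => m ν * G ν) 2
      (volume.restrict (Ioc (-(1 / (2 * T))) (1 / (2 * T)))) := by
    refine MemLp.of_le_mul (c := w) hG (hm.aestronglyMeasurable.mul hG.1) ?_
    filter_upwards [hae] with ν hν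
    rw [norm_mul]
    gcongr
  refine ((hasSum_sq_norm_integral_expi hT hmG).summable.sum_le_tsum K
    fun _ _ => by positivity).trans ?_
  rw [(hasSum_sq_norm_integral_expi hT hmG).tsum_eq]
  have h1 : ∫ ν in Ioc (-(1 / (2 * T))) (1 / (2 * T)), ‖m ν * G ν‖ ^ 2 ≤
      ∫ ν in Ioc (-(1 / (2 * T))) (1 / (2 * T)), w ^ 2 * ‖G ν‖ ^ 2 := by
    refine integral_mono_ae ((memLp_two_iff_integrable_sq_norm hmG.1).mp hmG)
      (((memLp_two_iff_integrable_sq_norm hG.1).mp hG).const_mul _) ?_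
    filter_upwards [hae] with ν hν
    rw [norm_mul, mul_pow]
    gcongr
  rw [integral_const_mul] at h1
  calc _ ≤ T⁻¹ * (w ^ 2 * ∫ ν in Ioc (-(1 / (2 * T))) (1 / (2 * T)), ‖G ν‖ ^ 2) := by gcongr
    _ = _ := by ring

/-- The derivative `cos z - z sin z` is nonnegative on `[0, π/4]`, since there `0 ≤ sin z ≤ cos z`
and `z ≤ 1`. -/
theorem mul_cos_le_mul_cos {x y : ℝ} (hx : 0 ≤ x) (hxy : x ≤ y) (hy : y ≤ π / 4) :
    x * cos x ≤ y * cos y := by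
  have hmono : MonotoneOn (fun x => x * cos x) (Icc 0 (π / 4)) := by
    refine monotoneOn_of_deriv_nonneg (convex_Icc _ _) (by fun_prop) (by fun_prop) fun z hz => ?_
    rw [interior_Icc] at hz
    have hd : HasDerivAt (fun x => x * cos x) (1 * cos z + z * (-sin z)) z :=
      (hasDerivAt_id z).mul (hasDerivAt_cos z)
    rw [hd.deriv]
    have hs : 0 ≤ sin z := sin_nonneg_of_nonneg_of_le_pi hz.1.le (by linarith [hz.2, pi_pos])
    have hc : sin z ≤ cos z := by
      rw [← cos_pi_div_two_sub]
      exact cos_le_cos_of_nonneg_of_le_pi hz.1.le (by linarith [hz.1, pi_pos])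
        (by linarith [hz.2])
    have h1 : z ≤ 1 := by linarith [hz.2, pi_lt_four]
    nlinarith
  exact hmono ⟨hx, hxy.trans hy⟩ ⟨hx.trans hxy, hy⟩ hxy

/-- Both factors grow with `|ν|`, so the band edge `|ν| = 1/(2T)` is extremal. -/
theorem abs_mul_sin_le {T r ν : ℝ} (hT : 0 < T) (hr : 0 ≤ r) (hrT : r ≤ T / 4)
    (hν : |ν| ≤ 1 / (2 * T)) :
    |2 * π * ν * sin (2 * π * r * ν)| ≤ π / T * sin (π * r / T) := by
  have hle : 2 * π * r * |ν| ≤ π * r / T := by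
    calc 2 * π * r * |ν| ≤ 2 * π * r * (1 / (2 * T)) := by gcongr
      _ = π * r / T := by field_simp
  have hle4 : π * r / T ≤ π / 4 := by
    rw [div_le_iff₀ hT]; nlinarith [pi_pos]
  have h0 : 0 ≤ 2 * π * r * |ν| := by positivity
  have hs : |sin (2 * π * r * ν)| = sin (2 * π * r * |ν|) := by
    have hs0 : 0 ≤ sin (2 * π * r * |ν|) :=
      sin_nonneg_of_nonneg_of_le_pi h0 (by linarith [pi_pos])
    rcases abs_cases ν with ⟨h, _⟩ | ⟨h, _⟩
    · rw [h] at hs0 ⊢; exact abs_of_nonneg hs0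
    · rw [h, mul_neg, sin_neg] at hs0 ⊢; exact abs_of_nonpos (by linarith)
  have hv : 2 * π * |ν| ≤ π / T := by
    calc 2 * π * |ν| ≤ 2 * π * (1 / (2 * T)) := by gcongr
      _ = π / T := by field_simp
  rw [abs_mul, hs, abs_mul, abs_of_pos (by positivity : (0 : ℝ) < 2 * π)]
  have hsin : sin (2 * π * r * |ν|) ≤ sin (π * r / T) :=
    sin_le_sin_of_le_of_le_pi_div_two (by linarith [pi_pos]) (by linarith [pi_pos]) hle
  have h2 : 0 ≤ sin (2 * π * r * |ν|) :=
    sin_nonneg_of_nonneg_of_le_pi h0 (by linarith [pi_pos])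
  gcongr

/-- Here the cosine decreases in `|ν|`; the band edge is still extremal because `x cos x` increases
on `[0, π/4]`. -/
theorem abs_mul_cos_le {T r ν : ℝ} (hT : 0 < T) (hr : 0 ≤ r) (hrT : r ≤ T / 4)
    (hν : |ν| ≤ 1 / (2 * T)) :
    |2 * π * ν * cos (2 * π * r * ν)| ≤ π / T * cos (π * r / T) := by
  have hle : 2 * π * r * |ν| ≤ π * r / T := by
    calc 2 * π * r * |ν| ≤ 2 * π * r * (1 / (2 * T)) := by gcongr
      _ = π * r / T := by field_simp
  have hle4 : π * r / T ≤ π / 4 := by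
    rw [div_le_iff₀ hT]; nlinarith [pi_pos]
  have h0 : 0 ≤ 2 * π * r * |ν| := by positivity
  have hc : |cos (2 * π * r * ν)| = cos (2 * π * r * |ν|) := by
    have hc0 : 0 ≤ cos (2 * π * r * |ν|) :=
      cos_nonneg_of_mem_Icc ⟨by linarith [pi_pos], by linarith [pi_pos]⟩
    rcases abs_cases ν with ⟨h, _⟩ | ⟨h, _⟩
    · rw [h] at hc0 ⊢; exact abs_of_nonneg hc0
    · rw [h, mul_neg, cos_neg] at hc0 ⊢; exact abs_of_nonneg hc0
  rw [abs_mul, hc, abs_mul, abs_of_pos (by positivity : (0 : ℝ) < 2 * π)]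
  -- The monotonicity of `x cos x` is applied after multiplying by `r`, which excludes `r = 0`.
  rcases hr.eq_or_lt with rfl | hr'
  · calc _ = 2 * π * |ν| := by simp
      _ ≤ 2 * π * (1 / (2 * T)) := by gcongr
      _ = _ := by field_simp; simp
  · refine le_of_mul_le_mul_left ?_ hr'
    calc _ = 2 * π * r * |ν| * cos (2 * π * r * |ν|) := by ring
      _ ≤ π * r / T * cos (π * r / T) := mul_cos_le_mul_cos h0 hle hle4
      _ = _ := by ring

theorem integral_sin_add_cos (T L : ℝ) :
    ∫ r in (0 : ℝ)..L, (π / T * sin (π * r / T) + π / T * cos (π * r / T)) =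
      1 - cos (π * L / T) + sin (π * L / T) := by
  have h : ∀ r ∈ uIcc 0 L, HasDerivAt (fun r => -cos (π * r / T) + sin (π * r / T))
      (π / T * sin (π * r / T) + π / T * cos (π * r / T)) r := by
    intro r _
    have h1 : HasDerivAt (fun r => π * r / T) (π * 1 / T) r :=
      ((hasDerivAt_id r).const_mul π).div_const T
    exact (h1.cos.neg.add h1.sin).congr_deriv (by ring)
  rw [intervalIntegral.integral_eq_sub_of_hasDerivAt h
    (Continuous.intervalIntegrable (by fun_prop) _ _)]
  simp
  ring

/-- The upper bound amounts to `sin θ < cos θ`. With `θ = πL/T` this is the source of the threshold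
`T/4`. -/
theorem one_sub_cos_add_sin_lt_one {θ : ℝ} (h0 : 0 ≤ θ) (h1 : θ < π / 4) :
    0 ≤ 1 - cos θ + sin θ ∧ 1 - cos θ + sin θ < 1 := by
  have hs : 0 ≤ sin θ := sin_nonneg_of_nonneg_of_le_pi h0 (by linarith [pi_pos])
  have hc : sin θ < cos θ := by
    rw [← cos_pi_div_two_sub]
    exact cos_lt_cos_of_nonneg_of_le_pi h0 (by linarith [pi_pos]) (by linarith)
  constructor <;> linarith [cos_le_one θ]

/-- The derivative `2πiν e(νr)` is written as a part even in `r` (cosine) and a part odd in `r`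
(sine). -/
theorem expi_sub_one_eq_integral (ν δ : ℝ) :
    expi ν δ - 1 = ∫ r in (0 : ℝ)..δ, (Complex.I * ((2 * π * ν * cos (2 * π * r * ν) : ℝ) : ℂ) -
      ((2 * π * ν * sin (2 * π * r * ν) : ℝ) : ℂ)) := by
  have h : ∀ r ∈ uIcc 0 δ, HasDerivAt (fun r : ℝ => expi ν r)
      (Complex.I * ((2 * π * ν * cos (2 * π * r * ν) : ℝ) : ℂ) -
        ((2 * π * ν * sin (2 * π * r * ν) : ℝ) : ℂ)) r := by
    intro r _
    have h1 : HasDerivAt (fun r : ℝ => (2 * π * Complex.I * ν * r : ℂ))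
        (2 * π * Complex.I * ν * 1) r :=
      (Complex.ofRealCLM.hasDerivAt (x := r)).const_mul _
    refine HasDerivAt.congr_deriv (f := fun r : ℝ => expi ν r) h1.cexp ?_
    have e : (2 * π * Complex.I * ν * r : ℂ) = ((2 * π * r * ν : ℝ) : ℂ) * Complex.I := by
      push_cast; ring
    rw [e, Complex.exp_mul_I]
    push_cast
    linear_combination (2 * π * ν * Complex.sin (2 * π * r * ν)) * Complex.I_sq
  rw [intervalIntegral.integral_eq_sub_of_hasDerivAt h
    (Continuous.intervalIntegrable (by fun_prop) _ _)]
  simp [expi]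

/-- If `m` is continuous, then so is `r ↦ ∫ m(r, ν) G(ν) e(νx) dν` over a bounded interval. -/
theorem continuous_integral_mul_expi {a b : ℝ} {G : ℝ → ℂ} {m : ℝ × ℝ → ℂ} (x : ℝ)
    (hG : Integrable G (volume.restrict (Ioc a b))) (hm : Continuous m)
    {C : ℝ} (hC : ∀ r, ∀ ν ∈ Ioc a b, ‖m (r, ν)‖ ≤ C) :
    Continuous fun r : ℝ => ∫ ν in Ioc a b, m (r, ν) * G ν * expi ν x := by
  refine continuous_of_dominated (bound := fun ν => C * ‖G ν‖) (fun r => ?_) (fun r => ?_)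
    (hG.norm.const_mul C) (Eventually.of_forall fun ν => by fun_prop)
  · exact ((by fun_prop : Continuous fun ν => m (r, ν)).aestronglyMeasurable.mul hG.1).mul
      (continuous_expi_left x).aestronglyMeasurable
  · refine (ae_restrict_iff' measurableSet_Ioc).mpr (Eventually.of_forall fun ν hν => ?_)
    rw [norm_mul, norm_mul, norm_expi, mul_one]
    have := hC r ν hν
    gcongr

/-- The bound depends on `δ` only through `L`. Hence one multiplier per `r` serves all `k`, whatever
the signs of the shifts, and Bessel's inequality can be applied over all `k` at once. -/
theorem norm_integral_mul_expi_sub_le {T L δ : ℝ} (hT : 0 < T) (hδ : |δ| ≤ L) {G : ℝ → ℂ}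
    (hG : Integrable G (volume.restrict (Ioc (-(1 / (2 * T))) (1 / (2 * T))))) (x : ℝ) :
    ‖∫ ν in Ioc (-(1 / (2 * T))) (1 / (2 * T)), G ν * expi ν x * (expi ν δ - 1)‖ ≤
      ∫ r in (0 : ℝ)..L,
        (‖∫ ν in Ioc (-(1 / (2 * T))) (1 / (2 * T)),
            ((2 * π * ν * sin (2 * π * r * ν) : ℝ) : ℂ) * G ν * expi ν x‖ +
          ‖∫ ν in Ioc (-(1 / (2 * T))) (1 / (2 * T)),
            ((2 * π * ν * cos (2 * π * r * ν) : ℝ) : ℂ) * G ν * expi ν x‖) := by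
  set I := Ioc (-(1 / (2 * T))) (1 / (2 * T)) with hI
  set ms : ℝ × ℝ → ℂ := fun p => ((2 * π * p.2 * sin (2 * π * p.1 * p.2) : ℝ) : ℂ) with hms
  set mc : ℝ × ℝ → ℂ := fun p => ((2 * π * p.2 * cos (2 * π * p.1 * p.2) : ℝ) : ℂ) with hmc
  have hmsc : Continuous ms := by fun_prop
  have hmcc : Continuous mc := by fun_prop
  have habs : ∀ ν ∈ I, |ν| ≤ 1 / (2 * T) := fun ν hν => abs_le.mpr ⟨hν.1.le, hν.2⟩
  have hbound : ∀ ν ∈ I, ∀ z : ℝ, |z| ≤ 1 → ‖((2 * π * ν * z : ℝ) : ℂ)‖ ≤ π / T := by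
    intro ν hν z hz
    rw [Complex.norm_real, norm_eq_abs, abs_mul, abs_mul,
      abs_of_pos (by positivity : (0 : ℝ) < 2 * π)]
    calc 2 * π * |ν| * |z| ≤ 2 * π * (1 / (2 * T)) * 1 := by
          have := habs ν hν; gcongr
      _ = π / T := by field_simp
  have hmsb : ∀ r, ∀ ν ∈ I, ‖ms (r, ν)‖ ≤ π / T := fun r ν hν => hbound ν hν _ (abs_sin_le_one _)
  have hmcb : ∀ r, ∀ ν ∈ I, ‖mc (r, ν)‖ ≤ π / T := fun r ν hν => hbound ν hν _ (abs_cos_le_one _)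
  set A : ℝ → ℂ := fun r => ∫ ν in I, ms (r, ν) * G ν * expi ν x with hA
  set B : ℝ → ℂ := fun r => ∫ ν in I, mc (r, ν) * G ν * expi ν x with hB
  have hAc : Continuous A := continuous_integral_mul_expi x hG hmsc hmsb
  have hBc : Continuous B := continuous_integral_mul_expi x hG hmcc hmcb
  have hint : ∀ (m : ℝ × ℝ → ℂ), Continuous m → (∀ r, ∀ ν ∈ I, ‖m (r, ν)‖ ≤ π / T) → ∀ r,
      Integrable (fun ν => m (r, ν) * G ν * expi ν x) (volume.restrict I) := by
    intro m hm hb r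
    have h1 : Integrable (fun ν => m (r, ν) * G ν) (volume.restrict I) :=
      hG.bdd_mul (c := π / T) (by fun_prop : Continuous fun ν => m (r, ν)).aestronglyMeasurable
        ((ae_restrict_iff' measurableSet_Ioc).mpr (Eventually.of_forall (hb r)))
    exact h1.mul_bdd (c := 1) (continuous_expi_left x).aestronglyMeasurable
      (Eventually.of_forall fun ν => (norm_expi ν x).le)
  have hswap : ∫ ν in I, G ν * expi ν x * (expi ν δ - 1) =
      ∫ r in (0 : ℝ)..δ, (Complex.I * B r - A r) := by
    have h1 : ∀ r, Complex.I * B r - A r =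
        ∫ ν in I, (Complex.I * mc (r, ν) - ms (r, ν)) * (G ν * expi ν x) := by
      intro r
      rw [hA, hB, ← integral_const_mul, ← integral_sub ((hint mc hmcc hmcb r).const_mul _)
        (hint ms hmsc hmsb r)]
      congr 1; funext ν; ring
    simp_rw [h1]
    rw [intervalIntegral_integral_swap]
    · congr 1; funext ν
      rw [intervalIntegral.integral_mul_const, expi_sub_one_eq_integral ν δ, mul_comm]
    · have : IsFiniteMeasure (volume.restrict (uIoc 0 δ)) := by rw [uIoc]; infer_instance
      have h2 : Integrable (fun p : ℝ × ℝ => G p.2 * expi p.2 x)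
          ((volume.restrict (uIoc 0 δ)).prod (volume.restrict I)) :=
        (hG.mul_bdd (c := 1) (continuous_expi_left x).aestronglyMeasurable
          (Eventually.of_forall fun ν => (norm_expi ν x).le)).comp_snd _
      refine h2.bdd_mul (c := π / T + π / T)
        (by fun_prop : Continuous fun p : ℝ × ℝ =>
          Complex.I * mc p - ms p).aestronglyMeasurable ?_
      rw [Measure.prod_restrict]
      refine (ae_restrict_iff' (measurableSet_uIoc.prod measurableSet_Ioc)).mpr
        (Eventually.of_forall fun p hp => ?_)
      refine (norm_sub_le _ _).trans (add_le_add ?_ (hmsb _ _ hp.2))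
      simpa using hmcb p.1 p.2 hp.2
  have hgc : Continuous fun r => ‖A r‖ + ‖B r‖ := hAc.norm.add hBc.norm
  -- The parity of sine and cosine reduces negative `δ` to positive `δ`.
  have heven : ∀ r, ‖A (-r)‖ + ‖B (-r)‖ = ‖A r‖ + ‖B r‖ := by
    intro r
    have h1 : A (-r) = -A r := by
      simp only [hA, hms, ← integral_neg]
      congr 1; funext ν
      rw [show 2 * π * -r * ν = -(2 * π * r * ν) by ring, sin_neg]
      push_cast; ring
    have h2 : B (-r) = B r := by
      simp only [hB, hmc]
      congr 1; funext ν
      rw [show 2 * π * -r * ν = -(2 * π * r * ν) by ring, cos_neg]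
    rw [h1, h2, norm_neg]
  have hpt : ∀ r, ‖Complex.I * B r - A r‖ ≤ ‖A r‖ + ‖B r‖ := by
    intro r
    refine (norm_sub_le _ _).trans ?_
    simp [add_comm]
  have hmono : ∫ r in (0 : ℝ)..|δ|, (‖A r‖ + ‖B r‖) ≤ ∫ r in (0 : ℝ)..L, (‖A r‖ + ‖B r‖) :=
    intervalIntegral.integral_mono_interval le_rfl (abs_nonneg δ) hδ
      (Eventually.of_forall fun r => by positivity) (hgc.intervalIntegrable _ _)
  rw [hswap]
  refine le_trans ?_ hmono
  rcases le_total 0 δ with h0 | h0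
  · rw [abs_of_nonneg h0]
    exact intervalIntegral.norm_integral_le_of_norm_le h0
      (Eventually.of_forall fun r _ => hpt r) (hgc.intervalIntegrable _ _)
  · rw [abs_of_nonpos h0, intervalIntegral.integral_symm, norm_neg]
    have h3 := intervalIntegral.norm_integral_le_of_norm_le h0
      (μ := volume) (Eventually.of_forall fun r _ => hpt r) (hgc.intervalIntegrable _ _)
    refine h3.trans (le_of_eq ?_)
    have h4 := intervalIntegral.integral_comp_neg (a := 0) (b := -δ) fun r => ‖A r‖ + ‖B r‖
    simp only [neg_neg, neg_zero] at h4
    rw [← h4]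
    simp_rw [heven]

/-- The perturbation estimate in Kadec's 1/4 theorem. -/
theorem sum_sq_norm_perturbation_le {T L : ℝ} (hT : 0 < T) (hL : 0 ≤ L) (hLT : L < T / 4)
    {G : ℝ → ℂ} (hG : MemLp G 2 (volume.restrict (Ioc (-(1 / (2 * T))) (1 / (2 * T)))))
    {δ : ℤ → ℝ} (hδ : ∀ k, |δ k| ≤ L) (K : Finset ℤ) :
    ∑ k ∈ K, ‖∫ ν in Ioc (-(1 / (2 * T))) (1 / (2 * T)),
        G ν * expi ν (k * T) * (expi ν (δ k) - 1)‖ ^ 2 ≤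
      (1 - cos (π * L / T) + sin (π * L / T)) ^ 2 *
        (T⁻¹ * ∫ ν in Ioc (-(1 / (2 * T))) (1 / (2 * T)), ‖G ν‖ ^ 2) := by
  have hGi : Integrable G (volume.restrict (Ioc (-(1 / (2 * T))) (1 / (2 * T)))) :=
    hG.integrable one_le_two
  set N := T⁻¹ * ∫ ν in Ioc (-(1 / (2 * T))) (1 / (2 * T)), ‖G ν‖ ^ 2 with hN
  have hN0 : 0 ≤ N := by
    have : 0 ≤ ∫ ν in Ioc (-(1 / (2 * T))) (1 / (2 * T)), ‖G ν‖ ^ 2 :=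
      integral_nonneg fun _ => by positivity
    positivity
  have hle := fun k => norm_integral_mul_expi_sub_le hT (hδ k) hGi (k * T)
  set c : ℤ → ℂ := fun k => ∫ ν in Ioc (-(1 / (2 * T))) (1 / (2 * T)),
    G ν * expi ν (k * T) * (expi ν (δ k) - 1) with hc
  set I := Ioc (-(1 / (2 * T))) (1 / (2 * T)) with hI
  have habs : ∀ ν ∈ I, |ν| ≤ 1 / (2 * T) := fun ν hν => abs_le.mpr ⟨hν.1.le, hν.2⟩
  set A : ℤ → ℝ → ℂ := fun k r =>
    ∫ ν in I, ((2 * π * ν * sin (2 * π * r * ν) : ℝ) : ℂ) * G ν * expi ν (k * T) with hA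
  set B : ℤ → ℝ → ℂ := fun k r =>
    ∫ ν in I, ((2 * π * ν * cos (2 * π * r * ν) : ℝ) : ℂ) * G ν * expi ν (k * T) with hB
  have hbound : ∀ ν ∈ I, ∀ z : ℝ, |z| ≤ 1 → ‖((2 * π * ν * z : ℝ) : ℂ)‖ ≤ π / T := by
    intro ν hν z hz
    rw [Complex.norm_real, norm_eq_abs, abs_mul, abs_mul,
      abs_of_pos (by positivity : (0 : ℝ) < 2 * π)]
    calc 2 * π * |ν| * |z| ≤ 2 * π * (1 / (2 * T)) * 1 := by
          have := habs ν hν; gcongr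
      _ = π / T := by field_simp
  have hAc : ∀ k, Continuous (A k) := fun k =>
    continuous_integral_mul_expi
      (m := fun p => ((2 * π * p.2 * sin (2 * π * p.1 * p.2) : ℝ) : ℂ)) _ hGi (by fun_prop)
      fun r ν hν => hbound ν hν _ (abs_sin_le_one _)
  have hBc : ∀ k, Continuous (B k) := fun k =>
    continuous_integral_mul_expi
      (m := fun p => ((2 * π * p.2 * cos (2 * π * p.1 * p.2) : ℝ) : ℂ)) _ hGi (by fun_prop)
      fun r ν hν => hbound ν hν _ (abs_cos_le_one _)
  set S := ∑ k ∈ K, ‖c k‖ ^ 2 with hS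
  have hS0 : 0 ≤ S := Finset.sum_nonneg fun _ _ => by positivity
  set W := 1 - cos (π * L / T) + sin (π * L / T) with hW
  have hW0 : 0 ≤ W := (one_sub_cos_add_sin_lt_one (by positivity)
    (by rw [div_lt_iff₀ hT]; nlinarith [pi_pos])).1
  -- Pairing with `c` itself and using Cauchy–Schwarz replaces Minkowski's integral inequality: it
  -- leads to `S ≤ √S √N W`, from which `√S` is cancelled.
  have hcs : ∀ r ∈ Icc 0 L, ∑ k ∈ K, ‖c k‖ * (‖A k r‖ + ‖B k r‖) ≤
      √S * √N * (π / T * sin (π * r / T) + π / T * cos (π * r / T)) := by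
    intro r hr
    have hrT : r ≤ T / 4 := hr.2.trans hLT.le
    have hrT2 : π * r / T ≤ π / 4 := by rw [div_le_iff₀ hT]; nlinarith [pi_pos]
    have hr0 : 0 ≤ π * r / T := by have := hr.1; positivity
    have hs0 : 0 ≤ sin (π * r / T) := sin_nonneg_of_nonneg_of_le_pi hr0 (by linarith [pi_pos])
    have hc0 : 0 ≤ cos (π * r / T) :=
      cos_nonneg_of_mem_Icc ⟨by linarith [pi_pos], by linarith [pi_pos]⟩
    have hAle : √(∑ k ∈ K, ‖A k r‖ ^ 2) ≤ π / T * sin (π * r / T) * √N := by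
      rw [← Real.sqrt_sq (by positivity : 0 ≤ π / T * sin (π * r / T)),
        ← Real.sqrt_mul (by positivity)]
      refine Real.sqrt_le_sqrt (sum_sq_norm_integral_mul_expi_le hT hG (by fun_prop) ?_ K)
      intro ν hν
      rw [Complex.norm_real]
      exact abs_mul_sin_le hT hr.1 hrT (habs ν hν)
    have hBle : √(∑ k ∈ K, ‖B k r‖ ^ 2) ≤ π / T * cos (π * r / T) * √N := by
      rw [← Real.sqrt_sq (by positivity : 0 ≤ π / T * cos (π * r / T)),
        ← Real.sqrt_mul (by positivity)]
      refine Real.sqrt_le_sqrt (sum_sq_norm_integral_mul_expi_le hT hG (by fun_prop) ?_ K)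
      intro ν hν
      rw [Complex.norm_real]
      exact abs_mul_cos_le hT hr.1 hrT (habs ν hν)
    simp_rw [mul_add]
    rw [Finset.sum_add_distrib]
    have h1 := Real.sum_mul_le_sqrt_mul_sqrt K (fun k => ‖c k‖) fun k => ‖A k r‖
    have h2 := Real.sum_mul_le_sqrt_mul_sqrt K (fun k => ‖c k‖) fun k => ‖B k r‖
    have h3 := mul_le_mul_of_nonneg_left hAle (Real.sqrt_nonneg S)
    have h4 := mul_le_mul_of_nonneg_left hBle (Real.sqrt_nonneg S)
    linarith
  have hSle : S ≤ √S * √N * W := by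
    calc S = ∑ k ∈ K, ‖c k‖ * ‖c k‖ := by simp_rw [hS, sq]
      _ ≤ ∑ k ∈ K, ‖c k‖ * ∫ r in (0 : ℝ)..L, (‖A k r‖ + ‖B k r‖) := by
        gcongr with k _
        exact hle k
      _ = ∫ r in (0 : ℝ)..L, ∑ k ∈ K, ‖c k‖ * (‖A k r‖ + ‖B k r‖) := by
        rw [intervalIntegral.integral_finsetSum]
        · simp_rw [intervalIntegral.integral_const_mul]
        · intro k _
          exact (continuous_const.mul ((hAc k).norm.add (hBc k).norm)).intervalIntegrable _ _
      _ ≤ ∫ r in (0 : ℝ)..L, √S * √N * (π / T * sin (π * r / T) + π / T * cos (π * r / T)) := by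
        refine intervalIntegral.integral_mono_on hL (Continuous.intervalIntegrable ?_ _ _)
          (Continuous.intervalIntegrable (by fun_prop) _ _) hcs
        exact continuous_finsetSum _ fun k _ =>
          continuous_const.mul ((hAc k).norm.add (hBc k).norm)
      _ = √S * √N * W := by
        rw [intervalIntegral.integral_const_mul, integral_sin_add_cos]
  have hsqrt : √S ≤ √N * W := by
    rcases (Real.sqrt_nonneg S).eq_or_lt with h | h
    · rw [← h]; positivity
    · refine le_of_mul_le_mul_left ?_ h
      rw [Real.mul_self_sqrt hS0, ← mul_assoc]
      exact hSle
  calc S = √S ^ 2 := (Real.sq_sqrt hS0).symm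
    _ ≤ (√N * W) ^ 2 := by gcongr
    _ = W ^ 2 * N := by rw [mul_pow, Real.sq_sqrt hN0, mul_comm]

theorem lintegral_enorm_sq_eq_ofReal {α : Type*} [MeasurableSpace α] {μ : Measure α} {f : α → ℂ}
    (hf : MemLp f 2 μ) : ∫⁻ x, ‖f x‖ₑ ^ 2 ∂μ = ENNReal.ofReal (∫ x, ‖f x‖ ^ 2 ∂μ) := by
  rw [ofReal_integral_eq_lintegral_ofReal ((memLp_two_iff_integrable_sq_norm hf.1).mp hf)
    (Eventually.of_forall fun _ => by positivity)]
  refine lintegral_congr fun x => ?_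
  rw [ENNReal.ofReal_pow (norm_nonneg _), ofReal_norm]

theorem memLp_two_iff_lintegral_enorm_sq {α : Type*} [MeasurableSpace α] {μ : Measure α}
    {f : α → ℂ} (hf : AEStronglyMeasurable f μ) :
    MemLp f 2 μ ↔ ∫⁻ x, ‖f x‖ₑ ^ 2 ∂μ < ∞ := by
  have h := eLpNorm_lt_top_iff_lintegral_rpow_enorm_lt_top (μ := μ) (f := f)
    (p := 2) two_ne_zero ENNReal.ofNat_ne_top
  simp only [ENNReal.toReal_ofNat, ENNReal.rpow_ofNat] at h
  rw [← h]
  exact ⟨fun h => h.2, fun h => ⟨hf, h⟩⟩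

/-- The frame inequality of Kadec's 1/4 theorem: samples at `λ_k` with `|λ_k - kT| ≤ L < T/4`
determine functions of bandwidth `1/T` stably. -/
theorem exists_frame_bounds {T L : ℝ} (hT : 0 < T) (hL : 0 ≤ L) (hLT : L < T / 4) :
    ∃ A B : ℝ, 0 < A ∧ 0 < B ∧ ∀ Λ : ℤ → ℝ, (∀ k, |Λ k - (k : ℝ) * T| ≤ L) →
      ∀ G : ℝ → ℂ, MemLp G 2 volume → (∀ ν, ν ∉ Icc (-(1 / (2 * T))) (1 / (2 * T)) → G ν = 0) →
        ENNReal.ofReal A * ∫⁻ ν, ‖G ν‖ₑ ^ 2 ≤ ∑' k, ‖∫ ν, G ν * expi ν (Λ k)‖ₑ ^ 2 ∧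
        ∑' k, ‖∫ ν, G ν * expi ν (Λ k)‖ₑ ^ 2 ≤ ENNReal.ofReal B * ∫⁻ ν, ‖G ν‖ₑ ^ 2 := by
  set W := 1 - cos (π * L / T) + sin (π * L / T) with hW
  obtain ⟨hW0, hW1⟩ : 0 ≤ W ∧ W < 1 := one_sub_cos_add_sin_lt_one (by positivity)
    (by rw [div_lt_iff₀ hT]; nlinarith [pi_pos])
  -- Any `ε` with `W² < ε < 1` suits the weighted estimate `hlow`; the midpoint of `W` and `1` is
  -- such a value.
  set ε := (1 + W) / 2 with hε
  have hε0 : 0 < ε := by rw [hε]; linarith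
  have hε1 : ε < 1 := by rw [hε]; linarith
  have hεW : W ^ 2 / ε < 1 := by rw [div_lt_one hε0, hε]; nlinarith
  refine ⟨(1 - ε) * (1 - W ^ 2 / ε) * T⁻¹, 4 * T⁻¹, ?_, by positivity, ?_⟩
  · have := sub_pos.mpr hε1
    have := sub_pos.mpr hεW
    positivity
  intro Λ hΛ G hG hG0
  set I := Ioc (-(1 / (2 * T))) (1 / (2 * T)) with hI
  have hGI : MemLp G 2 (volume.restrict I) := hG.restrict I
  have hae : ∀ᵐ ν : ℝ, ν ∉ I → G ν = 0 := by
    have h := (Ioc_ae_eq_Icc (μ := volume) (a := -(1 / (2 * T))) (b := 1 / (2 * T))).mem_iff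
    filter_upwards [h] with ν hν hνI
    exact hG0 ν fun h => hνI (hν.mpr h)
  have hset : ∀ x, ∫ ν in I, G ν * expi ν x = ∫ ν, G ν * expi ν x := fun x =>
    setIntegral_eq_integral_of_ae_compl_eq_zero <| by
      filter_upwards [hae] with ν hν hνI
      rw [hν hνI, zero_mul]
  set N := T⁻¹ * ∫ ν in I, ‖G ν‖ ^ 2 with hN
  have hN0 : 0 ≤ N := by
    have : 0 ≤ ∫ ν in I, ‖G ν‖ ^ 2 := integral_nonneg fun _ => by positivity
    positivity
  have hNG : ∫⁻ ν, ‖G ν‖ₑ ^ 2 = ENNReal.ofReal (T * N) := by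
    rw [lintegral_enorm_sq_eq_ofReal hG, hN, ← mul_assoc, mul_inv_cancel₀ hT.ne', one_mul]
    congr 1
    refine (setIntegral_eq_integral_of_ae_compl_eq_zero ?_).symm
    filter_upwards [hae] with ν hν hνI
    simp [hν hνI]
  set x : ℤ → ℂ := fun k => ∫ ν in I, G ν * expi ν (k * T) with hx
  set y : ℤ → ℂ := fun k => ∫ ν, G ν * expi ν (Λ k) with hy
  set c : ℤ → ℂ := fun k => ∫ ν in I, G ν * expi ν (k * T) * (expi ν (Λ k - k * T) - 1) with hc
  have hGi : Integrable G (volume.restrict I) := hGI.integrable one_le_two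
  have hmul : ∀ {F : ℝ → ℂ} (z : ℝ), Integrable F (volume.restrict I) →
      Integrable (fun ν => F ν * expi ν z) (volume.restrict I) := fun z hF =>
    hF.mul_bdd (c := 1) (continuous_expi_left z).aestronglyMeasurable
      (Eventually.of_forall fun ν => (norm_expi ν z).le)
  have hyxc : ∀ k, y k = x k + c k := by
    intro k
    have h1 : ∀ ν, G ν * expi ν (k * T) * (expi ν (Λ k - k * T) - 1) =
        G ν * expi ν (Λ k) - G ν * expi ν (k * T) := by
      intro ν
      have : expi ν (Λ k) = expi ν (k * T) * expi ν (Λ k - k * T) := by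
        rw [← expi_add]; congr 1; ring
      rw [this]; ring
    simp only [hy, hx, hc]
    simp_rw [h1]
    rw [integral_sub (hmul _ hGi) (hmul _ hGi), ← hset (Λ k)]
    ring
  have hxs : HasSum (fun k => ‖x k‖ ^ 2) N := hasSum_sq_norm_integral_expi hT hGI
  have hcK := sum_sq_norm_perturbation_le hT hL hLT hGI (δ := fun k => Λ k - k * T) hΛ
  have hcs : Summable fun k => ‖c k‖ ^ 2 :=
    summable_of_sum_le (fun _ => by positivity) hcK
  have hct : ∑' k, ‖c k‖ ^ 2 ≤ W ^ 2 * N := hcs.tsum_le_of_sum_le hcK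
  have hup : ∀ k, ‖y k‖ ^ 2 ≤ 2 * ‖x k‖ ^ 2 + 2 * ‖c k‖ ^ 2 := by
    intro k
    have h1 := norm_add_le (x k) (c k)
    rw [← hyxc k] at h1
    nlinarith [norm_nonneg (y k), norm_nonneg (x k), norm_nonneg (c k),
      sq_nonneg (‖x k‖ - ‖c k‖)]
  -- Young's inequality with weight `ε`; summed over `k` it leaves `(1 - ε)(1 - W²/ε) N > 0` when `N
  -- > 0`.
  have hlow : ∀ k, (1 - ε) * ‖x k‖ ^ 2 - (1 - ε) / ε * ‖c k‖ ^ 2 ≤ ‖y k‖ ^ 2 := by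
    intro k
    have h1 : ‖x k‖ ≤ ‖y k‖ + ‖c k‖ := by
      have h2 : x k = y k - c k := by rw [hyxc k]; ring
      rw [h2]; exact norm_sub_le _ _
    have h3 : ‖x k‖ ^ 2 ≤ (‖y k‖ + ‖c k‖) ^ 2 := by gcongr
    have h4 : (1 - ε) * (‖y k‖ + ‖c k‖) ^ 2 ≤ ‖y k‖ ^ 2 + (1 - ε) / ε * ‖c k‖ ^ 2 := by
      have h5 : ‖y k‖ ^ 2 + (1 - ε) / ε * ‖c k‖ ^ 2 - (1 - ε) * (‖y k‖ + ‖c k‖) ^ 2 =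
          (ε * ‖y k‖ - (1 - ε) * ‖c k‖) ^ 2 / ε := by
        field_simp; ring
      have h6 : 0 ≤ (ε * ‖y k‖ - (1 - ε) * ‖c k‖) ^ 2 / ε := by positivity
      linarith
    have h7 := mul_le_mul_of_nonneg_left h3 (sub_pos.mpr hε1).le
    linarith
  have hys : Summable fun k => ‖y k‖ ^ 2 :=
    Summable.of_nonneg_of_le (fun _ => by positivity) hup
      ((hxs.summable.mul_left 2).add (hcs.mul_left 2))
  have hyt : ∑' k, ‖y k‖ₑ ^ 2 = ENNReal.ofReal (∑' k, ‖y k‖ ^ 2) := by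
    rw [ENNReal.ofReal_tsum_of_nonneg (fun _ => by positivity) hys]
    refine tsum_congr fun k => ?_
    rw [ENNReal.ofReal_pow (norm_nonneg _), ofReal_norm]
  have hA0 : 0 ≤ (1 - ε) * (1 - W ^ 2 / ε) * T⁻¹ := by
    have := sub_pos.mpr hε1
    have := sub_pos.mpr hεW
    positivity
  rw [hyt, hNG, ← ENNReal.ofReal_mul hA0, ← ENNReal.ofReal_mul (by positivity)]
  constructor
  · refine ENNReal.ofReal_le_ofReal ?_
    have h1 := Summable.tsum_le_tsum hlow
      ((hxs.summable.mul_left _).sub (hcs.mul_left _)) hys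
    rw [(hxs.summable.mul_left _).tsum_sub (hcs.mul_left _), tsum_mul_left, tsum_mul_left,
      hxs.tsum_eq] at h1
    have h2 : (1 - ε) / ε * ∑' k, ‖c k‖ ^ 2 ≤ (1 - ε) / ε * (W ^ 2 * N) := by
      have := sub_pos.mpr hε1
      gcongr
    calc (1 - ε) * (1 - W ^ 2 / ε) * T⁻¹ * (T * N) =
        (1 - ε) * N - (1 - ε) / ε * (W ^ 2 * N) := by field_simp
      _ ≤ _ := by linarith
  · refine ENNReal.ofReal_le_ofReal ?_
    have h1 := Summable.tsum_le_tsum hup hys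
      ((hxs.summable.mul_left 2).add (hcs.mul_left 2))
    rw [(hxs.summable.mul_left _).tsum_add (hcs.mul_left _), tsum_mul_left, tsum_mul_left,
      hxs.tsum_eq] at h1
    have h2 : W ^ 2 * N ≤ N := mul_le_of_le_one_left hN0 (pow_le_one₀ hW0 hW1.le)
    calc _ ≤ 2 * N + 2 * N := by linarith
      _ = _ := by field_simp; ring

/-! ### Samples of functions in `S₀` and the Dirac comb -/

theorem fourier_mul_gauss_eq_stft (f : ℝ → ℂ) (t : ℝ) :
    𝓕 (fun x => f x * gauss (x - t)) = fun ν => stft f (t, ν) := by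
  funext ν
  rw [Real.fourier_real_eq_integral_exp_smul, stft]
  refine integral_congr_ae (Eventually.of_forall fun x => ?_)
  have h : Complex.exp (↑(-2 * π * x * ν) * Complex.I) = expi (-ν) x := by
    rw [expi]; congr 1; push_cast; ring
  simp only [h, smul_eq_mul]
  ring

/-- Pointwise control of a function in `S₀` by its short-time Fourier transform. -/
theorem MemS0.ae_norm_mul_gauss_le {f : ℝ → ℂ} (hf : MemS0 f) :
    ∀ᵐ t : ℝ, ∀ x, ‖f x‖ * ‖gauss (x - t)‖ ≤ ∫ ν, ‖stft f (t, ν)‖ := by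
  filter_upwards [Integrable.prod_right_ae (μ := volume) (ν := volume) hf.integrable_stft]
    with t ht x
  have hc : Continuous fun x => f x * gauss (x - t) :=
    hf.continuous.mul (continuous_gauss.comp (continuous_sub_right t))
  have hi : Integrable fun x => f x * gauss (x - t) := hf.memLp.integrable_mul (memLp_gauss t)
  have hF := fourier_mul_gauss_eq_stft f t
  -- Fourier inversion is available for almost every `t`, namely when the slice `V_g f(t, ·)` is
  -- integrable.
  have hinv := congrFun (hc.fourierInv_fourier_eq hi (by rw [hF]; exact ht)) x
  rw [hF, Real.fourierInv_eq] at hinv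
  rw [← norm_mul, ← hinv]
  refine (norm_integral_le_integral_norm _).trans (le_of_eq ?_)
  simp

theorem norm_gauss (x : ℝ) : ‖gauss x‖ = Real.exp (-π * x ^ 2) := by
  rw [gauss, Complex.norm_real, norm_eq_abs, abs_exp]

/-- Functions in `S₀` are uniformly summable over separated sets. -/
theorem sum_norm_le_S0norm {T : ℝ} (hT : 0 < T) {Λ : ℤ → ℝ}
    (hsep : ∀ k : ℤ, T ≤ Λ (k + 1) - Λ k) (f : S0) (K : Finset ℤ) :
    ∑ k ∈ K, ‖(f : ℝ → ℂ) (Λ k)‖ ≤ (T * Real.exp (-π * T ^ 2))⁻¹ * S0norm f := by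
  have hf : MemS0 (f : ℝ → ℂ) := f.2
  set V : ℝ → ℝ := fun t => ∫ ν, ‖stft (f : ℝ → ℂ) (t, ν)‖ with hV
  have hVi : Integrable V :=
    Integrable.integral_norm_prod_left (μ := volume) (ν := volume) hf.integrable_stft
  have hV0 : ∀ t, 0 ≤ V t := fun t => integral_nonneg fun _ => norm_nonneg _
  have hS : S0norm f = ∫ t, V t :=
    integral_prod (μ := volume) (ν := volume) _ hf.integrable_stft.norm
  have hmono : Monotone Λ := monotone_int_of_le_succ fun k => by linarith [hsep k]
  have hdisj : Pairwise (Function.onFun Disjoint fun k => Ico (Λ k) (Λ k + T)) := by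
    refine hmono.pairwise_disjoint_on_Ico_succ.mono fun i j h => h.mono ?_ ?_ <;>
    · refine Ico_subset_Ico_right ?_
      rw [Order.succ_eq_add_one]
      linarith [hsep i, hsep j]
  -- The pointwise bound is averaged over `t ∈ [Λ k, Λ k + T)`, where the window at `Λ k - t` is at
  -- least `exp(-πT²)`. These intervals are disjoint, so the averages add up to at most `‖f‖_{S₀}`.
  have hk : ∀ k, T * Real.exp (-π * T ^ 2) * ‖(f : ℝ → ℂ) (Λ k)‖ ≤
      ∫ t in Ico (Λ k) (Λ k + T), V t := by
    intro k
    have h1 : ∫ t in Ico (Λ k) (Λ k + T), Real.exp (-π * T ^ 2) * ‖(f : ℝ → ℂ) (Λ k)‖ =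
        T * Real.exp (-π * T ^ 2) * ‖(f : ℝ → ℂ) (Λ k)‖ := by
      simp [measureReal_def, hT.le]
      ring
    rw [← h1]
    refine setIntegral_mono_on_ae (integrableOn_const (by simp)) hVi.integrableOn measurableSet_Ico ?_
    filter_upwards [hf.ae_norm_mul_gauss_le] with t ht hmem
    refine le_trans ?_ (ht (Λ k))
    rw [mul_comm, norm_gauss]
    have h2 : (Λ k - t) ^ 2 ≤ T ^ 2 := sq_le_sq' (by linarith [hmem.2]) (by linarith [hmem.1])
    gcongr ?_ * Real.exp ?_
    nlinarith [pi_pos]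
  have hsum : ∑ k ∈ K, T * Real.exp (-π * T ^ 2) * ‖(f : ℝ → ℂ) (Λ k)‖ ≤ S0norm f := by
    calc _ ≤ ∑ k ∈ K, ∫ t in Ico (Λ k) (Λ k + T), V t := Finset.sum_le_sum fun k _ => hk k
      _ = ∫ t in ⋃ k ∈ K, Ico (Λ k) (Λ k + T), V t :=
        (integral_biUnion_finset K (fun _ _ => measurableSet_Ico)
          (fun i _ j _ hij => hdisj hij) fun _ _ => hVi.integrableOn).symm
      _ ≤ ∫ t, V t := setIntegral_le_integral hVi (Eventually.of_forall hV0)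
      _ = S0norm f := hS.symm
  rw [← Finset.mul_sum] at hsum
  rw [inv_mul_eq_div, le_div_iff₀ (by positivity), mul_comm]
  exact hsum

theorem summable_S0_samples {T : ℝ} (hT : 0 < T) {Λ : ℤ → ℝ}
    (hsep : ∀ k : ℤ, T ≤ Λ (k + 1) - Λ k) (f : S0) :
    Summable fun k => ‖(f : ℝ → ℂ) (Λ k)‖ :=
  summable_of_sum_le (fun _ => norm_nonneg _) (sum_norm_le_S0norm hT hsep f)

/-- The Dirac comb `∑ δ_{Λ k}` over a separated set as an element of `S₀'`. -/
noncomputable def diracComb {T : ℝ} (hT : 0 < T) {Λ : ℤ → ℝ}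
    (hsep : ∀ k : ℤ, T ≤ Λ (k + 1) - Λ k) : S0Dual where
  toLinearMap :=
    { toFun := fun f => ∑' k, (f : ℝ → ℂ) (Λ k)
      map_add' := fun f g =>
        (summable_S0_samples hT hsep f).of_norm.tsum_add (summable_S0_samples hT hsep g).of_norm
      map_smul' := fun c f => by
        simp only [Submodule.coe_smul, Pi.smul_apply, RingHom.id_apply, smul_eq_mul]
        exact tsum_mul_left }
  bounded := by
    refine ⟨(T * Real.exp (-π * T ^ 2))⁻¹, fun f => ?_⟩
    exact (norm_tsum_le_tsum_norm (summable_S0_samples hT hsep f)).trans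
      ((summable_S0_samples hT hsep f).tsum_le_of_sum_le (sum_norm_le_S0norm hT hsep f))

/-! ### The `L²` Fourier transform and spreading functions -/

theorem IsL2Fourier.congr {f g F F' : ℝ → ℂ} (h : IsL2Fourier f F) (hfg : f =ᵐ[volume] g)
    (hF : F =ᵐ[volume] F') : IsL2Fourier g F' := by
  obtain ⟨hf, hF0⟩ := h
  refine ⟨hf.ae_eq hfg, ?_⟩
  rw [← MemLp.toLp_congr hf (hf.ae_eq hfg) hfg]
  exact hF.symm.trans hF0

/-- Injectivity of the Fourier transform; it serves to recognise the intermediate function of the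
symplectic transform as the impulse response. -/
theorem IsL2Fourier.ae_eq {f g F : ℝ → ℂ} (hf : IsL2Fourier f F) (hg : IsL2Fourier g F) :
    f =ᵐ[volume] g := by
  obtain ⟨hf, hF⟩ := hf
  obtain ⟨hg, hF'⟩ := hg
  have h : (𝓕 (hf.toLp f) : L2R) = 𝓕 (hg.toLp g) := Lp.ext (hF.symm.trans hF')
  have h2 : hf.toLp f = hg.toLp g := (Lp.fourierTransformₗᵢ ℝ ℂ).injective h
  exact (MemLp.toLp_eq_toLp_iff hf hg).mp h2

theorem lintegral_enorm_sq_Lp {α : Type*} [MeasurableSpace α] {μ : Measure α} (f : Lp ℂ 2 μ) :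
    ∫⁻ x, ‖f x‖ₑ ^ 2 ∂μ = ENNReal.ofReal (‖f‖ ^ 2) := by
  have h : ((∫ x, ‖f x‖ ^ 2 ∂μ : ℝ) : ℂ) = ((‖f‖ ^ 2 : ℝ) : ℂ) := by
    have h2 := inner_self_eq_norm_sq_to_K (𝕜 := ℂ) f
    rw [L2.inner_def] at h2
    simp_rw [inner_self_eq_norm_sq_to_K] at h2
    rw [← integral_complex_ofReal]
    push_cast
    exact h2
  rw [lintegral_enorm_sq_eq_ofReal (Lp.memLp f), Complex.ofReal_injective h]

/-- Plancherel's theorem. -/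
theorem IsL2Fourier.lintegral_enorm_sq {f F : ℝ → ℂ} (h : IsL2Fourier f F) :
    ∫⁻ x, ‖f x‖ₑ ^ 2 = ∫⁻ x, ‖F x‖ₑ ^ 2 := by
  obtain ⟨hf, hF⟩ := h
  have h1 : ∫⁻ x, ‖F x‖ₑ ^ 2 = ∫⁻ x, ‖(𝓕 (hf.toLp f) : L2R) x‖ₑ ^ 2 :=
    lintegral_congr_ae (by filter_upwards [hF] with x hx; rw [hx])
  have h2 : ∫⁻ x, ‖f x‖ₑ ^ 2 = ∫⁻ x, ‖(hf.toLp f) x‖ₑ ^ 2 :=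
    lintegral_congr_ae (by filter_upwards [hf.coeFn_toLp] with x hx; rw [hx])
  rw [h1, h2, lintegral_enorm_sq_Lp, lintegral_enorm_sq_Lp, Lp.norm_fourier_eq]

/-- Every point off `S` has a neighbourhood in which `F` vanishes almost everywhere, and a locally
null set in the plane is null. -/
theorem ae_eq_zero_of_essSupport_subset {F : ℝ × ℝ → ℂ} {S : Set (ℝ × ℝ)}
    (h : essSupport F ⊆ S) : ∀ᵐ q : ℝ × ℝ, q ∉ S → F q = 0 := by
  rw [ae_iff]
  refine measure_null_of_locally_null _ fun p hp => ?_
  simp only [Classical.not_imp, mem_ofPred_eq] at hp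
  have hp2 : p ∉ essSupport F := fun hmem => hp.1 (h hmem)
  simp only [essSupport, mem_ofPred_eq, not_forall, not_not] at hp2
  obtain ⟨U, hU, hUF⟩ := hp2
  refine ⟨U ∩ {a | ¬(a ∉ S → F a = 0)},
    inter_mem (mem_nhdsWithin_of_mem_nhds hU) self_mem_nhdsWithin, ?_⟩
  refine measure_mono_null ?_ (ae_iff.mp hUF)
  rintro q ⟨hqU, hq⟩
  simp only [Classical.not_imp, mem_ofPred_eq] at hq ⊢
  exact ⟨hqU, hq.2⟩

theorem HilbertSchmidt.measurable_kernel (H : HilbertSchmidt) : Measurable (H.kernel : ℝ × ℝ → ℂ) :=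
  (Lp.stronglyMeasurable H.kernel).measurable

theorem HilbertSchmidt.measurable_impulseResponse (H : HilbertSchmidt) :
    Measurable fun p : ℝ × ℝ => H.impulseResponse p.1 p.2 :=
  H.measurable_kernel.comp (by fun_prop)

/-- An operator in `OPW(S)` has a spreading function with essential support in `S`. -/
theorem exists_isSpreadingFunction_of_mem_OPW {H : HilbertSchmidt} {S : Set (ℝ × ℝ)}
    (hH : H ∈ OPW S) : ∃ η, IsSpreadingFunction H η ∧ essSupport η ⊆ S := by
  obtain ⟨σ, F, hσ, ⟨_, hF, G, hG, hGσ, hGF⟩, hsupp⟩ := hH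
  refine ⟨F, ⟨hF, ?_⟩, hsupp⟩
  have hmk : ∀ᵐ p : ℝ × ℝ, G p = hG.1.mk G p := hG.1.ae_eq_mk
  have h1 : ∀ᵐ t : ℝ, ∀ᵐ x : ℝ, G (t, x) = hG.1.mk G (t, x) :=
    Measure.ae_ae_of_ae_prod (μ := volume) (ν := volume) hmk
  have h2 : ∀ᵐ x : ℝ, ∀ᵐ t : ℝ, G (t, x) = hG.1.mk G (t, x) :=
    Measure.ae_ae_of_ae_prod (μ := volume) (ν := volume) (p := fun q => G q.swap = hG.1.mk G q.swap)
      ((Measure.measurePreserving_swap (μ := volume) (ν := volume)).quasiMeasurePreserving.ae hmk)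
  -- For almost every `x`, both functions of `t` have the Fourier transform `σ(x, ·)`.
  have h3 : ∀ᵐ x : ℝ, ∀ᵐ t : ℝ, hG.1.mk G (t, x) = H.impulseResponse t x := by
    filter_upwards [h2, hGσ, hσ.2] with x hx hxσ hHσ
    filter_upwards [hx, hxσ.ae_eq hHσ] with t ht ht2
    rw [← ht, ht2]
  -- Exchanging the two quantifiers requires a measurable set of equality, hence the measurable
  -- representative of `G`.
  have h4 : ∀ᵐ t : ℝ, ∀ᵐ x : ℝ, hG.1.mk G (t, x) = H.impulseResponse t x := by
    rw [Measure.ae_ae_comm]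
    · exact h3
    · exact measurableSet_eq_fun (hG.1.stronglyMeasurable_mk.measurable)
        H.measurable_impulseResponse
  filter_upwards [h1, h4, hGF] with t ht ht2 htF
  refine htF.congr ?_ EventuallyEq.rfl
  filter_upwards [ht, ht2] with x hx hx2
  rw [hx, hx2]

/-- The spreading function may be taken measurable and zero off its support rectangle. -/
theorem exists_measurable_isSpreadingFunction {H : HilbertSchmidt} {T : ℝ} {J : Set ℝ}
    (hJ : MeasurableSet J) (hH : H ∈ OPW (Icc 0 T ×ˢ J)) :
    ∃ η, IsSpreadingFunction H η ∧ Measurable η ∧ ∀ p, p ∉ Ico 0 T ×ˢ J → η p = 0 := by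
  obtain ⟨η₀, ⟨hη₀, hF⟩, hsupp⟩ := exists_isSpreadingFunction_of_mem_OPW hH
  have hD : MeasurableSet (Ico 0 T ×ˢ J) := measurableSet_Ico.prod hJ
  -- Dropping the null line `t = T` makes the translated supports disjoint at every point, even when
  -- a gap of `Λ` equals `T`.
  set η := (Ico 0 T ×ˢ J).indicator (hη₀.1.mk η₀) with hη
  have hT : ∀ᵐ p : ℝ × ℝ, p.1 ≠ T :=
    (Measure.quasiMeasurePreserving_fst (μ := (volume : Measure ℝ))
      (ν := (volume : Measure ℝ))).ae (Measure.ae_ne volume T)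
  have hae : η₀ =ᵐ[volume] η := by
    filter_upwards [hη₀.1.ae_eq_mk, ae_eq_zero_of_essSupport_subset hsupp, hT] with p h1 h2 h3
    by_cases hp : p ∈ Ico 0 T ×ˢ J
    · rw [hη, indicator_of_mem hp, h1]
    · rw [hη, indicator_of_notMem hp]
      refine h2 fun hp2 => hp ⟨⟨hp2.1.1, lt_of_le_of_ne hp2.1.2 h3⟩, hp2.2⟩
  refine ⟨η, ⟨hη₀.ae_eq hae, ?_⟩, hη₀.1.stronglyMeasurable_mk.measurable.indicator hD,
    fun p hp => indicator_of_notMem hp _⟩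
  filter_upwards [hF, Measure.ae_ae_of_ae_prod (μ := volume) (ν := volume) hae] with t ht ht2
  exact ht.congr EventuallyEq.rfl ht2

/-- The spreading function has the Hilbert–Schmidt norm as its `L²` norm. -/
theorem IsSpreadingFunction.lintegral_enorm_sq {H : HilbertSchmidt} {η : ℝ × ℝ → ℂ}
    (h : IsSpreadingFunction H η) :
    ∫⁻ t, ∫⁻ ν, ‖η (t, ν)‖ₑ ^ 2 = ENNReal.ofReal (H.hsNorm ^ 2) := by
  have hm : Measurable fun p : ℝ × ℝ => ‖H.kernel p‖ₑ ^ 2 := H.measurable_kernel.enorm.pow_const 2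
  calc ∫⁻ t, ∫⁻ ν, ‖η (t, ν)‖ₑ ^ 2 = ∫⁻ t, ∫⁻ x, ‖H.impulseResponse t x‖ₑ ^ 2 :=
        lintegral_congr_ae (by filter_upwards [h.2] with t ht; rw [ht.lintegral_enorm_sq])
    _ = ∫⁻ x, ∫⁻ t, ‖H.impulseResponse t x‖ₑ ^ 2 :=
        lintegral_lintegral_swap (H.measurable_impulseResponse.enorm.pow_const 2).aemeasurable
    _ = ∫⁻ x, ∫⁻ t, ‖H.kernel (x, t)‖ₑ ^ 2 := lintegral_congr fun x =>
        lintegral_sub_left_eq_self (fun t => ‖H.kernel (x, t)‖ₑ ^ 2) x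
    _ = ∫⁻ p, ‖H.kernel p‖ₑ ^ 2 := (lintegral_prod _ hm.aemeasurable).symm
    _ = _ := lintegral_enorm_sq_Lp _

theorem measurable_tsum {α : Type*} [MeasurableSpace α] {f : ℤ → α → ℂ}
    (hf : ∀ k, Measurable (f k)) (hs : ∀ x, Summable fun k => f k x) :
    Measurable fun x => ∑' k, f k x :=
  measurable_of_tendsto_metrizable' (atTop : Filter (Finset ℤ))
    (fun s => Finset.measurable_fun_sum s fun k _ => hf k)
    (tendsto_pi_nhds.mpr fun x => (hs x).hasSum)

/-! ### The value of an operator at a Dirac comb -/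

/-- The partial inverse Fourier transform `h(t, x) = ∫ η(t, ν) exp(2πiνx) dν`. -/
noncomputable def partialFourierInv (η : ℝ × ℝ → ℂ) (t x : ℝ) : ℂ := ∫ ν, η (t, ν) * expi ν x

/-- The value `∑_k h(x - Λ k, x)` at the Dirac comb `∑_k δ_{Λ k}` of the operator with spreading
function `η`. -/
noncomputable def combResponse (η : ℝ × ℝ → ℂ) (Λ : ℤ → ℝ) (x : ℝ) : ℂ :=
  ∑' k, partialFourierInv η (x - Λ k) x

variable {η : ℝ × ℝ → ℂ} {T : ℝ} {J : Set ℝ} {Λ : ℤ → ℝ}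

theorem measurable_partialFourierInv (hη : Measurable η) :
    Measurable fun p : ℝ × ℝ => partialFourierInv η p.1 p.2 := by
  have h : Measurable fun q : (ℝ × ℝ) × ℝ => η (q.1.1, q.2) * expi q.2 q.1.2 :=
    (hη.comp ((measurable_fst.comp measurable_fst).prodMk measurable_snd)).mul
      (continuous_expi_uncurry.measurable.comp
        (measurable_snd.prodMk (measurable_snd.comp measurable_fst)))
  exact (StronglyMeasurable.integral_prod_right (ν := volume) h.stronglyMeasurable).measurable

theorem partialFourierInv_eq_zero (h0 : ∀ p, p ∉ Ico 0 T ×ˢ J → η p = 0) {t : ℝ}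
    (ht : t ∉ Ico 0 T) (x : ℝ) : partialFourierInv η t x = 0 := by
  have h : ∀ ν, η (t, ν) = 0 := fun ν => h0 _ fun hp => ht hp.1
  simp [partialFourierInv, h]

theorem enorm_partialFourierInv_le (η : ℝ × ℝ → ℂ) (t x : ℝ) :
    ‖partialFourierInv η t x‖ₑ ≤ ∫⁻ ν, ‖η (t, ν)‖ₑ := by
  refine (enorm_integral_le_lintegral_enorm _).trans (le_of_eq ?_)
  refine lintegral_congr fun ν => ?_
  rw [enorm_mul, ← ofReal_norm (expi ν x), norm_expi]
  simp

/-- At every point at most one term of the sum defining `combResponse` is nonzero. -/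
theorem exists_partialFourierInv_eq_zero (hsep : ∀ k : ℤ, T ≤ Λ (k + 1) - Λ k) (hT : 0 < T)
    (h0 : ∀ p, p ∉ Ico 0 T ×ˢ J → η p = 0) (x : ℝ) :
    ∃ k₀ : ℤ, ∀ k, k ≠ k₀ → partialFourierInv η (x - Λ k) x = 0 := by
  by_cases h : ∃ k₀ : ℤ, x - Λ k₀ ∈ Ico 0 T
  · obtain ⟨k₀, hk₀⟩ := h
    have hmono : Monotone Λ := monotone_int_of_le_succ fun k => by linarith [hsep k]
    refine ⟨k₀, fun k hk => partialFourierInv_eq_zero h0 (fun hmem => ?_) x⟩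
    rcases lt_or_gt_of_ne hk with hlt | hlt
    · linarith [hmono (show k + 1 ≤ k₀ by lia), hsep k, hmem.1, hmem.2, hk₀.1, hk₀.2]
    · linarith [hmono (show k₀ + 1 ≤ k by lia), hsep k₀, hmem.1, hmem.2, hk₀.1, hk₀.2]
  · exact ⟨0, fun k _ => partialFourierInv_eq_zero h0 (fun hmem => h ⟨k, hmem⟩) x⟩

theorem summable_partialFourierInv (hsep : ∀ k : ℤ, T ≤ Λ (k + 1) - Λ k) (hT : 0 < T)
    (h0 : ∀ p, p ∉ Ico 0 T ×ˢ J → η p = 0) (x : ℝ) :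
    Summable fun k => partialFourierInv η (x - Λ k) x := by
  obtain ⟨k₀, hk₀⟩ := exists_partialFourierInv_eq_zero hsep hT h0 x
  exact (hasSum_single k₀ hk₀).summable

theorem measurable_partialFourierInv_sub (hη : Measurable η) (a : ℝ) :
    Measurable fun x => partialFourierInv η (x - a) x :=
  (measurable_partialFourierInv hη).comp
    ((measurable_id.sub_const a).prodMk measurable_id)

theorem measurable_combResponse (hsep : ∀ k : ℤ, T ≤ Λ (k + 1) - Λ k) (hT : 0 < T)
    (hη : Measurable η) (h0 : ∀ p, p ∉ Ico 0 T ×ˢ J → η p = 0) :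
    Measurable (combResponse η Λ) :=
  measurable_tsum (fun k => measurable_partialFourierInv_sub hη (Λ k))
    (summable_partialFourierInv hsep hT h0)

/-- At most one summand is nonzero at each point, so the square of the sum is the sum of the
squares; each term is then translated by `Λ k`. -/
theorem lintegral_enorm_sq_combResponse (hsep : ∀ k : ℤ, T ≤ Λ (k + 1) - Λ k) (hT : 0 < T)
    (hη : Measurable η) (h0 : ∀ p, p ∉ Ico 0 T ×ˢ J → η p = 0) :
    ∫⁻ x, ‖combResponse η Λ x‖ₑ ^ 2 =
      ∫⁻ t, ∑' k, ‖partialFourierInv η t (t + Λ k)‖ₑ ^ 2 := by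
  have h1 : ∀ x, ‖combResponse η Λ x‖ₑ ^ 2 = ∑' k, ‖partialFourierInv η (x - Λ k) x‖ₑ ^ 2 := by
    intro x
    obtain ⟨k₀, hk₀⟩ := exists_partialFourierInv_eq_zero hsep hT h0 x
    rw [combResponse, tsum_eq_single k₀ hk₀, tsum_eq_single k₀]
    intro k hk
    rw [hk₀ k hk]; simp
  have hm : ∀ k, Measurable fun t => partialFourierInv η t (t + Λ k) := fun k =>
    (measurable_partialFourierInv hη).comp (measurable_id.prodMk (measurable_id.add_const _))
  simp_rw [h1]
  rw [lintegral_tsum fun k =>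
      ((measurable_partialFourierInv_sub hη (Λ k)).enorm.pow_const 2).aemeasurable,
    lintegral_tsum fun k => ((hm k).enorm.pow_const 2).aemeasurable]
  refine tsum_congr fun k => ?_
  rw [← lintegral_add_right_eq_self (fun x => ‖partialFourierInv η (x - Λ k) x‖ₑ ^ 2) (Λ k)]
  simp

/-- The two-sided norm estimate for the response to the Dirac comb. -/
theorem exists_combResponse_bounds {T L Ω : ℝ} (hT : 0 < T) (hL : 0 ≤ L) (hLT : L < T / 4)
    (hTΩ : T * Ω ≤ 1) :
    ∃ A B : ℝ, 0 < A ∧ 0 < B ∧ ∀ Λ : ℤ → ℝ, (∀ k, |Λ k - (k : ℝ) * T| ≤ L) →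
      (∀ k : ℤ, T ≤ Λ (k + 1) - Λ k) → ∀ η : ℝ × ℝ → ℂ, Measurable η → MemLp η 2 volume →
      (∀ p, p ∉ Ico 0 T ×ˢ Icc (-(Ω / 2)) (Ω / 2) → η p = 0) →
        ENNReal.ofReal A * ∫⁻ t, ∫⁻ ν, ‖η (t, ν)‖ₑ ^ 2 ≤ ∫⁻ x, ‖combResponse η Λ x‖ₑ ^ 2 ∧
        ∫⁻ x, ‖combResponse η Λ x‖ₑ ^ 2 ≤ ENNReal.ofReal B * ∫⁻ t, ∫⁻ ν, ‖η (t, ν)‖ₑ ^ 2 := by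
  obtain ⟨A, B, hA, hB, hAB⟩ := exists_frame_bounds hT hL hLT
  refine ⟨A, B, hA, hB, fun Λ hΛ hsep η hη hη2 h0 => ?_⟩
  have hm2 : Measurable fun p => ‖η p‖ₑ ^ 2 := hη.enorm.pow_const 2
  have hfin : ∫⁻ t, ∫⁻ ν, ‖η (t, ν)‖ₑ ^ 2 < ∞ := by
    have h := (memLp_two_iff_lintegral_enorm_sq hη2.1).mp hη2
    rwa [Measure.volume_eq_prod, lintegral_prod _ hm2.aemeasurable] at h
  have hmi : Measurable fun t => ∫⁻ ν, ‖η (t, ν)‖ₑ ^ 2 := hm2.lintegral_prod_right'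
  -- This is where `TΩ ≤ 1` enters: the band fits into the Kadec interval.
  have hΩT : Ω / 2 ≤ 1 / (2 * T) := by
    rw [div_le_div_iff₀ two_pos (by positivity)]; linarith
  have key : ∀ᵐ t : ℝ,
      ENNReal.ofReal A * ∫⁻ ν, ‖η (t, ν)‖ₑ ^ 2 ≤
        ∑' k, ‖partialFourierInv η t (t + Λ k)‖ₑ ^ 2 ∧
      ∑' k, ‖partialFourierInv η t (t + Λ k)‖ₑ ^ 2 ≤
        ENNReal.ofReal B * ∫⁻ ν, ‖η (t, ν)‖ₑ ^ 2 := by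
    filter_upwards [ae_lt_top hmi hfin.ne] with t ht
    -- Sampling at `t + Λ k` becomes sampling at `Λ k` once `e(νt)` is absorbed into the function,
    -- which does not change its modulus.
    have hGm : Measurable fun ν => η (t, ν) * expi ν t :=
      (hη.comp measurable_prodMk_left).mul (continuous_expi_left t).measurable
    have hGn : ∀ ν, ‖η (t, ν) * expi ν t‖ₑ = ‖η (t, ν)‖ₑ := by
      intro ν
      rw [enorm_mul, ← ofReal_norm (expi ν t), norm_expi]; simp
    have hG2 : MemLp (fun ν => η (t, ν) * expi ν t) 2 volume := by
      rw [memLp_two_iff_lintegral_enorm_sq hGm.aestronglyMeasurable]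
      simp_rw [hGn]
      exact ht
    have h := hAB Λ hΛ _ hG2 fun ν hν => by
      rw [h0 (t, ν) fun hp => hν ⟨by linarith [hp.2.1], by linarith [hp.2.2]⟩, zero_mul]
    simp_rw [hGn] at h
    have h2 : ∀ k, ∫ ν, η (t, ν) * expi ν t * expi ν (Λ k) =
        partialFourierInv η t (t + Λ k) := by
      intro k
      simp_rw [partialFourierInv, expi_add, mul_assoc]
    simp_rw [h2] at h
    exact h
  rw [lintegral_enorm_sq_combResponse hsep hT hη h0, ← lintegral_const_mul _ hmi,
    ← lintegral_const_mul _ hmi]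
  exact ⟨lintegral_mono_ae (key.mono fun _ h => h.1), lintegral_mono_ae (key.mono fun _ h => h.2)⟩

/-- Translation preserves the gaps of `Λ`, so the bound is uniform in `t`. -/
theorem tsum_enorm_S0_le (hT : 0 < T) (hsep : ∀ k : ℤ, T ≤ Λ (k + 1) - Λ k) (g : S0) (t : ℝ) :
    ∑' k, ‖(g : ℝ → ℂ) (Λ k + t)‖ₑ ≤
      ENNReal.ofReal ((T * Real.exp (-π * T ^ 2))⁻¹ * S0norm g) := by
  have hsep' : ∀ k : ℤ, T ≤ (Λ (k + 1) + t) - (Λ k + t) := fun k => by linarith [hsep k]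
  have hs := summable_S0_samples hT (Λ := fun k => Λ k + t) hsep' g
  have h1 : ∑' k, ‖(g : ℝ → ℂ) (Λ k + t)‖ₑ = ENNReal.ofReal (∑' k, ‖(g : ℝ → ℂ) (Λ k + t)‖) := by
    rw [ENNReal.ofReal_tsum_of_nonneg (fun _ => norm_nonneg _) hs]
    simp_rw [ofReal_norm]
  rw [h1]
  exact ENNReal.ofReal_le_ofReal
    (hs.tsum_le_of_sum_le (sum_norm_le_S0norm hT (Λ := fun k => Λ k + t) hsep' g))

theorem diracComb_tfPairing (hT : 0 < T) (hsep : ∀ k : ℤ, T ≤ Λ (k + 1) - Λ k) (g : S0)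
    (t ν : ℝ) : (diracComb hT hsep).tfPairing t ν g =
      ∑' k, expi ν (Λ k + t) * (g : ℝ → ℂ) (Λ k + t) := rfl

theorem summable_tfPairing (hT : 0 < T) (hsep : ∀ k : ℤ, T ≤ Λ (k + 1) - Λ k) (g : S0)
    (t ν : ℝ) : Summable fun k => expi ν (Λ k + t) * (g : ℝ → ℂ) (Λ k + t) :=
  (summable_S0_samples hT hsep (tfTranspose t ν g)).of_norm

/-- The weak formula for the value of an operator at a Dirac comb. -/
theorem integrable_and_integral_combResponse_mul (hT : 0 < T)
    (hsep : ∀ k : ℤ, T ≤ Λ (k + 1) - Λ k) (hη : Measurable η) (hηi : Integrable η) (g : S0) :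
    Integrable (fun p : ℝ × ℝ => η p * (diracComb hT hsep).tfPairing p.1 p.2 g) volume ∧
      ∫ x, combResponse η Λ x * (g : ℝ → ℂ) x =
        ∫ p : ℝ × ℝ, η p * (diracComb hT hsep).tfPairing p.1 p.2 g := by
  have hg : Measurable (g : ℝ → ℂ) := (MemS0.continuous g.2).measurable
  have hem : Measurable fun p : ℝ × ℝ => expi p.1 p.2 := continuous_expi_uncurry.measurable
  set C := (T * Real.exp (-π * T ^ 2))⁻¹ * S0norm g with hC
  set q : ℤ → ℝ × ℝ → ℂ := fun k p => expi p.2 (Λ k + p.1) * (g : ℝ → ℂ) (Λ k + p.1) with hq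
  have hqm : ∀ k, Measurable (q k) := fun k =>
    (hem.comp (measurable_snd.prodMk (measurable_fst.const_add _))).mul
      (hg.comp (measurable_fst.const_add _))
  have hpm : Measurable fun p : ℝ × ℝ => ∑' k, q k p :=
    measurable_tsum hqm fun p => summable_tfPairing hT hsep g p.1 p.2
  have hqn : ∀ k p, ‖q k p‖ₑ = ‖(g : ℝ → ℂ) (Λ k + p.1)‖ₑ := by
    intro k p
    rw [hq, enorm_mul, ← ofReal_norm (expi _ _), norm_expi]; simp
  have hpb : ∀ p : ℝ × ℝ, ‖∑' k, q k p‖ ≤ C := fun p => by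
    have h1 : Summable fun k => ‖q k p‖ := summable_S0_samples hT hsep (tfTranspose p.1 p.2 g)
    refine (norm_tsum_le_tsum_norm h1).trans ?_
    have hsep' : ∀ k : ℤ, T ≤ (Λ (k + 1) + p.1) - (Λ k + p.1) := fun k => by linarith [hsep k]
    refine h1.tsum_le_of_sum_le fun K => ?_
    refine le_trans (le_of_eq (Finset.sum_congr rfl fun k _ => ?_))
      (sum_norm_le_S0norm hT (Λ := fun k => Λ k + p.1) hsep' g K)
    rw [hq, norm_mul, norm_expi, one_mul]
  have hηm : Measurable fun p => ‖η p‖ₑ := hη.enorm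
  have hL1 : ∫⁻ p, ‖η p‖ₑ ≠ ∞ := hηi.2.ne
  have hgm : ∀ k, Measurable fun t => ‖(g : ℝ → ℂ) (Λ k + t)‖ₑ := fun k =>
    (hg.comp (measurable_id.const_add _)).enorm
  have hηg : ∀ k, Measurable fun p : ℝ × ℝ => ‖η p‖ₑ * ‖(g : ℝ → ℂ) (Λ k + p.1)‖ₑ := fun k =>
    hηm.mul ((hgm k).comp measurable_fst)
  have hηq : ∀ k, Measurable fun p => η p * q k p := fun k => hη.mul (hqm k)
  have hhg : ∀ k, Measurable fun x => partialFourierInv η (x - Λ k) x * (g : ℝ → ℂ) x := fun k =>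
    (measurable_partialFourierInv_sub hη (Λ k)).mul hg
  -- This one absolute bound, by `C ‖η‖_{L¹}`, justifies interchanging sum and integral on both
  -- sides of the weak formula.
  have hfin : ∑' k, ∫⁻ p : ℝ × ℝ, ‖η p‖ₑ * ‖(g : ℝ → ℂ) (Λ k + p.1)‖ₑ ≠ ∞ := by
    rw [← lintegral_tsum fun k => (hηg k).aemeasurable]
    refine ne_top_of_le_ne_top (ENNReal.mul_ne_top hL1 (ENNReal.ofReal_ne_top (r := C))) ?_
    rw [← lintegral_mul_const _ hηm]
    refine lintegral_mono fun p => ?_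
    rw [ENNReal.tsum_mul_left]
    gcongr
    exact tsum_enorm_S0_le hT hsep g p.1
  have hterm : ∀ k, ∫⁻ p, ‖η p * q k p‖ₑ = ∫⁻ p : ℝ × ℝ, ‖η p‖ₑ * ‖(g : ℝ → ℂ) (Λ k + p.1)‖ₑ :=
    fun k => lintegral_congr fun p => by rw [enorm_mul, hqn]
  refine ⟨hηi.mul_bdd hpm.aestronglyMeasurable (Eventually.of_forall hpb), ?_⟩
  have hR : ∫ p : ℝ × ℝ, η p * (diracComb hT hsep).tfPairing p.1 p.2 g =
      ∑' k, ∫ p : ℝ × ℝ, η p * q k p := by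
    rw [← integral_tsum fun k => (hηq k).aestronglyMeasurable]
    · congr 1; funext p
      rw [diracComb_tfPairing, ← tsum_mul_left]
    · simp_rw [hterm]; exact hfin
  have hLt : ∑' k, ∫⁻ x, ‖partialFourierInv η (x - Λ k) x * (g : ℝ → ℂ) x‖ₑ ≠ ∞ := by
    refine ne_top_of_le_ne_top hfin (ENNReal.tsum_le_tsum fun k => ?_)
    rw [← lintegral_add_right_eq_self _ (Λ k), Measure.volume_eq_prod,
      lintegral_prod _ (hηg k).aemeasurable]
    refine lintegral_mono fun t => ?_
    have hηt : Measurable fun ν => ‖η (t, ν)‖ₑ := hηm.comp measurable_prodMk_left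
    rw [enorm_mul, add_sub_cancel_right, add_comm t]
    change _ ≤ ∫⁻ ν, ‖η (t, ν)‖ₑ * ‖(g : ℝ → ℂ) (Λ k + t)‖ₑ
    rw [lintegral_mul_const _ hηt]
    gcongr
    exact enorm_partialFourierInv_le η t _
  have hLs : ∫ x, combResponse η Λ x * (g : ℝ → ℂ) x =
      ∑' k, ∫ x, partialFourierInv η (x - Λ k) x * (g : ℝ → ℂ) x := by
    rw [← integral_tsum (fun k => (hhg k).aestronglyMeasurable) hLt]
    congr 1; funext x
    rw [combResponse, tsum_mul_right]
  rw [hLs, hR]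
  -- The terms agree one by one, by Fubini and the substitution `x = t + Λ k`.
  refine tsum_congr fun k => ?_
  have hik : Integrable (fun p => η p * q k p) volume := by
    refine ⟨(hηq k).aestronglyMeasurable, ?_⟩
    rw [HasFiniteIntegral, hterm]
    exact lt_top_iff_ne_top.mpr (ENNReal.ne_top_of_tsum_ne_top hfin k)
  rw [Measure.volume_eq_prod, integral_prod _ hik,
    ← integral_add_right_eq_self (fun x => partialFourierInv η (x - Λ k) x * (g : ℝ → ℂ) x) (Λ k)]
  congr 1; funext t
  rw [add_sub_cancel_right, add_comm t, partialFourierInv, ← integral_mul_const]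
  simp only [hq, mul_assoc]

end OperatorSampling

/-! ### The sampling theorem -/

theorem corollary4p4 (T Ω L : ℝ) (hΩ : 0 < Ω) (Λ : ℤ → ℝ)
    (hmono : ∀ k : ℤ, Λ k < Λ (k + 1))
    (hL : 0 ≤ L) (hLT : L < T / 4)
    (hclose : ∀ k : ℤ, |Λ k - (k : ℝ) * T| ≤ L)
    (hsep : ∀ k : ℤ, T ≤ Λ (k + 1) - Λ k)
    (hTΩ : T * Ω ≤ 1) :
    OperatorSampling.IsSetOfSampling Λ
      (OperatorSampling.OPW (Set.Icc (0 : ℝ) T ×ˢ Set.Icc (-(Ω / 2)) (Ω / 2))) := by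
  open OperatorSampling in
  have hT : 0 < T := by linarith
  refine ⟨fun _ => 1, ⟨1, fun _ => by simp⟩, diracComb hT hsep, fun g => ?_, ?_⟩
  · simp only [one_mul]
    exact (summable_S0_samples hT hsep g).of_norm.hasSum
  obtain ⟨A, B, hA, hB, hAB⟩ := exists_combResponse_bounds hT hL hLT hTΩ
  refine ⟨√A, √B, Real.sqrt_pos.mpr hA, Real.sqrt_pos.mpr hB, fun H hH => ?_⟩
  obtain ⟨η, hηH, hηm, h0⟩ := exists_measurable_isSpreadingFunction measurableSet_Icc hH
  obtain ⟨hlow, hup⟩ := hAB Λ hclose hsep η hηm hηH.1 h0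
  rw [hηH.lintegral_enorm_sq, ← ENNReal.ofReal_mul hA.le] at hlow
  rw [hηH.lintegral_enorm_sq, ← ENNReal.ofReal_mul hB.le] at hup
  have hum := (measurable_combResponse hsep hT hηm h0).aestronglyMeasurable (μ := volume)
  have hu2 : MemLp (combResponse η Λ) 2 volume :=
    (memLp_two_iff_lintegral_enorm_sq hum).mpr (hup.trans_lt ENNReal.ofReal_lt_top)
  have hnorm : ∫⁻ x, ‖combResponse η Λ x‖ₑ ^ 2 = ENNReal.ofReal (‖hu2.toLp‖ ^ 2) := by
    rw [← lintegral_enorm_sq_Lp]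
    exact lintegral_congr_ae (by filter_upwards [hu2.coeFn_toLp] with x hx; rw [hx])
  have hH0 : 0 ≤ H.hsNorm := norm_nonneg _
  rw [hnorm, ENNReal.ofReal_le_ofReal_iff (by positivity)] at hlow hup
  -- On a rectangle of finite measure `L²` is contained in `L¹`.
  have hηi : Integrable η volume := by
    have hD : MeasureTheory.volume (Ico 0 T ×ˢ Icc (-(Ω / 2)) (Ω / 2)) ≠ ∞ := by
      rw [Measure.volume_eq_prod, Measure.prod_prod]
      exact ENNReal.mul_ne_top (by simp) (by simp)
    have : IsFiniteMeasure (volume.restrict (Ico 0 T ×ˢ Icc (-(Ω / 2)) (Ω / 2))) :=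
      isFiniteMeasure_restrict.mpr hD
    refine (integrableOn_iff_integrable_of_support_subset fun p hp => ?_).mp
      ((hηH.1.restrict (Ico 0 T ×ˢ Icc (-(Ω / 2)) (Ω / 2))).integrable one_le_two)
    by_contra hnot
    exact hp (h0 p hnot)
  refine ⟨hu2.toLp, ⟨η, hηH, fun g => ?_⟩, ?_, ?_⟩
  · obtain ⟨hi, he⟩ := integrable_and_integral_combResponse_mul hT hsep hηm hηi g
    refine ⟨hi, ?_⟩
    rw [← he]
    exact integral_congr_ae (by filter_upwards [hu2.coeFn_toLp] with x hx; rw [hx])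
  · refine le_of_sq_le_sq ?_ (norm_nonneg _)
    rw [mul_pow, Real.sq_sqrt hA.le]; exact hlow
  · refine le_of_sq_le_sq ?_ (by positivity)
    rw [mul_pow, Real.sq_sqrt hB.le]; exact hup
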